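/- Let $n\ge 1$, let $S=S^{n-1}$ carry its rotation-invariant probability measure $ds$, and let $\mathcal L=L^\infty(S)$. A scalar product on $\mathcal L$ is a symmetric bilinear form $B$ with $c\|u\|_{L^2(S)}^2\le B(u,u)\le C\|u\|_{L^2(S)}^2$ for some constants $c,C>0$; its norm is the least such $C$. Let $\mathcal U\subset\mathcal L$ be open and let $G=\{G_\phi\}_{\phi\in\mathcal U}$ be a Riemannian metric in $\mathcal U$, i.e. a family of scalar products on $\mathcal L$ depending smoothly on $\phi$ (from the $L^\infty$-norm to this norm). Let $(M,g)$ be a smooth $n$-dimensional Riemannian manifold and let $\Phi:M\to\mathcal U$ be a smooth isometric immersion: $G_{\Phi(x)}(d_x\Phi(v),d_x\Phi(w))=g_x(v,w)$. Put $T_x\Phi=d_x\Phi(T_xM)\subset\mathcal L$. *Projections.* Let $P:\mathcal U\to M$ be a projection, i.e.: (0) $P$ is $L^2$-smooth: it is differentiable for the $L^\infty$ structure, each derivative $d_\phi P:\mathcal L\to T_{P(\phi)}M$ extends to a bounded linear map on $L^2(S)$, and this extension depends smoothly on $\phi$; (1) $P\circ\Phi=\mathrm{id}_M$; (2) $d_{\Phi(x)}P(V)=0$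 for every $x\in M$ and every $V\in\mathcal L$ that is $G_{\Phi(x)}$-orthogonal to $T_x\Phi$. *Jacobian.* $J_GP(\phi)$ is the supremum, over all $n$-dimensional linear subspaces $Y\subset\mathcal L$, of the $n$-dimensional volume expansion coefficient of $d_\phi P|_Y:(Y,G_\phi|_Y)\to (T_{P(\phi)}M,g)$. *Mean curvature.* Let $V\in\mathcal L$ be $G_{\Phi(x)}$-orthogonal to $T_x\Phi$. Choose a smooth finite-dimensional submanifold $F\subset\mathcal U$ that contains $\Phi(N)$ for some neighbourhood $N$ of $x$ and to which $V$ is tangent at $\Phi(x)$. For $T\in T_x\Phi$ choose a smooth vector field $\tilde T$ tangent to $\Phi$ near $\Phi(x)$ with $\tilde T(\Phi(x))=T$, and put $\mathrm{II}_V(T,T)=G(\nabla_T\tilde T,V)$, where $\nabla$ is the Levi-Civita connection of the metric induced by $G$ on $F$. The mean curvature $H_V^{\Phi,x}$ is the trace of the quadratic form $\mathrm{II}_V$ on $T_x\Phi$ with respect to $G_{\Phi(x)}$. *Special embeddings and metrics.* $\Phi$ is a special embedding if there are functions $\Phi_s:M\to\mathbb R$ $(s\in S)$ such that $\Phi(x)$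 is represented by $s\mapsto\Phi_s(x)$ for every $x$, the function $(x,s)\mapsto\Phi_s(x)$ is smooth on $M\times S$, $|\operatorname{grad}\Phi_s|\equiv1$ on $M$ for every $s$, and for every $x$ the map $s\mapsto\operatorname{grad}\Phi_s(x)$ is a diffeomorphism from $S$ onto the unit sphere $UT_xM$ of $T_xM$. In that case let $\mu_x$ be the push-forward to $S$, under the inverse of this diffeomorphism, of the rotation-invariant probability measure of $UT_xM$. Then $G$ is special with respect to $\Phi$ if $G_\phi(X,Y)=n\int_S XY\,d\nu_\phi$ for all $\phi\in\mathcal U$ and $X,Y\in\mathcal L$, where each $\nu_\phi$ is a probability measure on $S$ whose density with respect to $ds$ lies in $L^\infty(S)$ and is bounded below by a positive constant, these densities depend smoothly (as elements of $L^\infty(S)$) on $\phi$, and $\nu_{\Phi(x)}=\mu_x$ for all $x\in M$. **Proposition.** For every $x\in M$ and every $V\in\mathcal L$ that is $G_{\Phi(x)}$-orthogonal to $T_x\Phi$, the mean curvature $H_V^{\Phi,x}$ is well defined (a submanifold $F$ as above exists, and $\mathrm{II}_V$ is a quadratic form that does not depend on the choices of $F$ and $\tilde T$), the function $J_GP$ is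 differentiable at $\Phi(x)$ (for the $L^\infty$ structure), and $$ d_{\Phi(x)}J_GP(V)=H_V^{\Phi,x}. $$ In particular, if $\Phi$ is a special embedding and $G$ is a special metric with respect to $\Phi$, then $d_{\Phi(x)}J_GP(V)=0$ for all such $x$ and $V$. -/

import Mathlib

open Set Filter Topology MeasureTheory
open scoped Manifold ContDiff

noncomputable section

/-! ### The sphere `S = S^{n-1}`, the spaces `L^∞(S)` and `L²(S)`; throughout `n = m + 1` -/

/-- Euclidean space `ℝⁿ`, `n = m + 1`. -/
abbrev Eucl (m : ℕ) : Type := EuclideanSpace ℝ (Fin (m + 1))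

/-- The unit sphere `S^{n-1}` of `ℝⁿ`, `n = m + 1`. -/
abbrev Sph (m : ℕ) : Type := Metric.sphere (0 : Eucl m) 1

/-- The rotation invariant probability measure on the sphere: the normalized surface measure. -/
def sphereMeasure (m : ℕ) : Measure (Sph m) :=
  ((volume : Measure (Eucl m)).toSphere univ)⁻¹ • (volume : Measure (Eucl m)).toSphere

instance instIsProbabilityMeasureSphere (m : ℕ) : IsProbabilityMeasure (sphereMeasure m) := by
  constructor
  have h0 : (volume : Measure (Eucl m)).toSphere univ ≠ 0 := by
    rw [Ne, Measure.measure_univ_eq_zero]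
    exact Measure.toSphere_ne_zero _
  have h1 : (volume : Measure (Eucl m)).toSphere univ ≠ ⊤ := measure_ne_top _ _
  simp only [sphereMeasure, Measure.smul_apply, smul_eq_mul]
  exact ENNReal.inv_mul_cancel h0 h1

/-- `𝓛 = L^∞(S)`. -/
abbrev Linf (m : ℕ) : Type := Lp ℝ (⊤ : ENNReal) (sphereMeasure m)

/-- `L²(S)`. -/
abbrev Ltwo (m : ℕ) : Type := Lp ℝ 2 (sphereMeasure m)

/-- The inclusion `L^∞(S) ⊆ L²(S)`. -/
def toL2 (m : ℕ) : Linf m →ₗ[ℝ] Ltwo m where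
  toFun u := ⟨u.1, Lp.antitone le_top u.2⟩
  map_add' _ _ := rfl
  map_smul' _ _ := rfl

/-! ### Scalar products and Riemannian metrics on open subsets of `L^∞(S)` -/

/-- Bilinear forms on `𝓛`. -/
abbrev LForm (m : ℕ) : Type := Linf m →ₗ[ℝ] Linf m →ₗ[ℝ] ℝ

/-- An (`L²`-compatible) scalar product on `𝓛`. -/
structure IsScalarProduct {m : ℕ} (B : LForm m) : Prop where
  symm : ∀ u v, B u v = B v u
  compatible : ∃ c > 0, ∃ C > 0, ∀ u,
    c * ‖toL2 m u‖ ^ 2 ≤ B u u ∧ B u u ≤ C * ‖toL2 m u‖ ^ 2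

/-- A Riemannian metric in `U ⊆ 𝓛`: a family of scalar products which is smooth with respect to
the norm of scalar products.  A scalar product extends by density to a unique bounded symmetric
bilinear form on `L²(S)`, and its norm (the least `C` with `B u u ≤ C ‖u‖²`) is the operator
norm of that extension; so smoothness is that of the family of extensions. -/
structure IsRiemannianMetric {m : ℕ} (U : Set (Linf m)) (G : Linf m → LForm m) : Prop where
  scalar : ∀ φ ∈ U, IsScalarProduct (G φ)
  smooth : ∃ Gt : Linf m → Ltwo m →L[ℝ] Ltwo m →L[ℝ] ℝ,
    (∀ φ ∈ U, ∀ u v, Gt φ (toL2 m u) (toL2 m v) = G φ u v) ∧ ContDiffOn ℝ ∞ Gt U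

/-! ### Jacobians -/

/-- For scalar products `B` on `E` and `h` on `X`, a linear map `L : E → X` and a subspace `Y` of
`E` with basis `b`, the volume expansion coefficient of `L|_Y : (Y, B) → (X, h)`.
It does not depend on the basis `b` of `Y`. -/
def jacobianOn {E X : Type*} [AddCommGroup E] [Module ℝ E] {n : ℕ}
    (B : E → E → ℝ) (h : X → X → ℝ) (L : E → X) {Y : Submodule ℝ E}
    (b : Module.Basis (Fin n) ℝ Y) : ℝ :=
  Real.sqrt ((Matrix.of fun i j => h (L (b i)) (L (b j))).det /
    (Matrix.of fun i j => B (b i) (b j)).det)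

/-- The `n`-dimensional Jacobian of `L`: the supremum of `jacobianOn` over all `n`-dimensional
subspaces `Y`. -/
def linearJacobian {E X : Type*} [AddCommGroup E] [Module ℝ E] (n : ℕ)
    (B : E → E → ℝ) (h : X → X → ℝ) (L : E → X) : ℝ :=
  sSup {j | ∃ (Y : Submodule ℝ E) (b : Module.Basis (Fin n) ℝ Y), j = jacobianOn B h L b}

section Manifold

variable {m : ℕ} {M : Type*} [TopologicalSpace M] [ChartedSpace (Eucl m) M]
  [IsManifold (𝓡 (m + 1)) ∞ M]

/-- The `n`-dimensional Jacobian `J_G P` of a map `P : 𝓛 → (M, g)`. -/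
def mapJacobian
    (g : Bundle.ContMDiffRiemannianMetric (𝓡 (m + 1)) ∞ (Eucl m)
      (fun x : M => TangentSpace (𝓡 (m + 1)) x))
    (G : Linf m → LForm m) (P : Linf m → M) (φ : Linf m) : ℝ :=
  linearJacobian (m + 1) (fun u v => G φ u v) (fun v w => g.inner (P φ) v w)
    (fun u : Linf m => mfderiv 𝓘(ℝ, Linf m) (𝓡 (m + 1)) P φ u)

/-! ### Isometric immersions and projections -/

/-- The differential `d_x Φ : T_x M → 𝓛`. -/
def surfDeriv (Φ : M → Linf m) (x : M) : TangentSpace (𝓡 (m + 1)) x →L[ℝ] Linf m :=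
  mfderiv (𝓡 (m + 1)) 𝓘(ℝ, Linf m) Φ x

/-- The tangent space `T_x Φ ⊆ 𝓛`. -/
def surfTangent (Φ : M → Linf m) (x : M) : Submodule ℝ (Linf m) :=
  LinearMap.range (surfDeriv Φ x).toLinearMap

/-- `V` is orthogonal to `T_x Φ`. -/
def IsNormal (G : Linf m → LForm m) (Φ : M → Linf m) (x : M) (V : Linf m) : Prop :=
  ∀ T ∈ surfTangent Φ x, G (Φ x) T V = 0

/-- `Φ : (M, g) → (U, G)` is a smooth isometric immersion. -/
structure IsSmoothIsometricImmersion
    (g : Bundle.ContMDiffRiemannianMetric (𝓡 (m + 1)) ∞ (Eucl m)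
      (fun x : M => TangentSpace (𝓡 (m + 1)) x))
    (U : Set (Linf m)) (G : Linf m → LForm m) (Φ : M → Linf m) : Prop where
  smooth : ContMDiff (𝓡 (m + 1)) 𝓘(ℝ, Linf m) ∞ Φ
  mem : ∀ x, Φ x ∈ U
  isometric : ∀ (x : M) (v w : TangentSpace (𝓡 (m + 1)) x),
    G (Φ x) (surfDeriv Φ x v) (surfDeriv Φ x w) = g.inner x v w

/-- `P : U → M` is `L²`-smooth: it is differentiable for the `L^∞` structure, every derivative
extends to a bounded linear map `D φ` on `L²(S)`, and `D φ`, read in the local trivializations of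
`TM`, depends smoothly on `φ`. -/
def IsL2Smooth (U : Set (Linf m)) (P : Linf m → M) : Prop :=
  (∀ φ ∈ U, MDifferentiableAt 𝓘(ℝ, Linf m) (𝓡 (m + 1)) P φ) ∧
  ∃ D : (φ : Linf m) → Ltwo m →L[ℝ] TangentSpace (𝓡 (m + 1)) (P φ),
    (∀ φ ∈ U, ∀ u : Linf m,
      D φ (toL2 m u) = mfderiv 𝓘(ℝ, Linf m) (𝓡 (m + 1)) P φ u) ∧
    ∀ φ₀ ∈ U, ContDiffAt ℝ ∞ (fun φ =>
      ((trivializationAt (Eucl m) (TangentSpace (𝓡 (m + 1))) (P φ₀)).continuousLinearMapAt ℝ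
        (P φ)).comp (D φ)) φ₀

/-- `P : U → M` is a projection for the isometric immersion `Φ : M → (U, G)`. -/
structure IsProjection (U : Set (Linf m)) (G : Linf m → LForm m) (Φ : M → Linf m)
    (P : Linf m → M) : Prop where
  l2smooth : IsL2Smooth U P
  retraction : ∀ x, P (Φ x) = x
  normal : ∀ (x : M) (V : Linf m), IsNormal G Φ x V →
    mfderiv 𝓘(ℝ, Linf m) (𝓡 (m + 1)) P (Φ x) V = 0

/-! ### Second fundamental form and mean curvature -/

/-- A smooth finite-dimensional submanifold `F` of `U` (given by a local parametrization
`ψ : W → F`, `W ⊆ ℝᵏ` open) which contains `Φ(N)` for a neighbourhood `N` of `x` and is tangent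
to `V` at `Φ(x)`.  Here `σ = ψ⁻¹ ∘ Φ` and `V` has coordinate vector `Vc` in the chart `ψ⁻¹`. -/
structure AuxSubmanifold (U : Set (Linf m)) (Φ : M → Linf m) (x : M) (V : Linf m) where
  k : ℕ
  W : Set (EuclideanSpace ℝ (Fin k))
  isOpen : IsOpen W
  ψ : EuclideanSpace ℝ (Fin k) → Linf m
  smooth : ContDiffOn ℝ ∞ ψ W
  mapsTo : MapsTo ψ W U
  immersive : ∀ p ∈ W, Function.Injective (fderiv ℝ ψ p)
  embedding : IsEmbedding (W.domRestrict ψ)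
  σ : M → EuclideanSpace ℝ (Fin k)
  σ_smooth : ContMDiffAt (𝓡 (m + 1)) 𝓘(ℝ, EuclideanSpace ℝ (Fin k)) ∞ σ x
  σ_mem : ∀ᶠ y in 𝓝 x, σ y ∈ W
  σ_lift : ∀ᶠ y in 𝓝 x, ψ (σ y) = Φ y
  Vc : EuclideanSpace ℝ (Fin k)
  tangent : fderiv ℝ ψ (σ x) Vc = V

/-- The Christoffel symbol of the first kind `h(Γ(X, Y), Z)` at `p` of the Levi-Civita connection
`∇_X Y = D_X Y + Γ(X, Y)` of a Riemannian metric `h` on an open set of `ℝᵏ`. -/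
def christoffel {E : Type*} [NormedAddCommGroup E] [NormedSpace ℝ E] (h : E → E → E → ℝ)
    (p X Y Z : E) : ℝ :=
  (1 / 2) * (fderiv ℝ (fun q => h q Y Z) p X + fderiv ℝ (fun q => h q X Z) p Y
    - fderiv ℝ (fun q => h q X Y) p Z)

namespace AuxSubmanifold

variable {U : Set (Linf m)} {Φ : M → Linf m} {x : M} {V : Linf m}

/-- The Riemannian metric on `F` induced by `G`, in the chart `ψ⁻¹`. -/
def metric (F : AuxSubmanifold U Φ x V) (G : Linf m → LForm m)
    (p X Y : EuclideanSpace ℝ (Fin F.k)) : ℝ :=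
  G (F.ψ p) (fderiv ℝ F.ψ p X) (fderiv ℝ F.ψ p Y)

/-- The chart expression `dσ(τ)` of the vector field `dΦ(τ)` tangent to `Φ`. -/
def field (F : AuxSubmanifold U Φ x V) (τ : (y : M) → TangentSpace (𝓡 (m + 1)) y) (y : M) :
    EuclideanSpace ℝ (Fin F.k) :=
  mfderiv (𝓡 (m + 1)) 𝓘(ℝ, EuclideanSpace ℝ (Fin F.k)) F.σ y (τ y)

/-- `G(∇_T T̃, V)` for the vector field `T̃ = dΦ(τ)` tangent to `Φ` and its value `T` at `x`, where
`∇` is the Levi-Civita connection of the metric induced on `F`, computed in the chart `ψ⁻¹`. -/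
def covDerivPairing (F : AuxSubmanifold U Φ x V) (G : Linf m → LForm m)
    (τ : (y : M) → TangentSpace (𝓡 (m + 1)) y) : ℝ :=
  F.metric G (F.σ x)
      (mfderiv (𝓡 (m + 1)) 𝓘(ℝ, EuclideanSpace ℝ (Fin F.k)) (F.field τ) x (τ x)) F.Vc
    + christoffel (F.metric G) (F.σ x) (F.field τ x) (F.field τ x) F.Vc

end AuxSubmanifold

/-- `II` is the second fundamental form of `Φ` at `x` with respect to `V`:
`II(T) = G(∇_T T̃, V)`, for all (and at least one) auxiliary submanifolds `F` and all
smooth vector fields `T̃ = dΦ(τ)` tangent to `Φ` near `x`, where `T = T̃(Φ(x))`. -/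
def IsSecondFundamentalForm (U : Set (Linf m)) (G : Linf m → LForm m) (Φ : M → Linf m) (x : M)
    (V : Linf m) (II : QuadraticForm ℝ (surfTangent Φ x)) : Prop :=
  Nonempty (AuxSubmanifold U Φ x V) ∧
  ∀ (F : AuxSubmanifold U Φ x V) (τ : (y : M) → TangentSpace (𝓡 (m + 1)) y),
    ContMDiffAt (𝓡 (m + 1)) (𝓡 (m + 1)).tangent ∞
      (fun y => (⟨y, τ y⟩ : TangentBundle (𝓡 (m + 1)) M)) x →
    II ⟨surfDeriv Φ x (τ x), LinearMap.mem_range_self _ _⟩ = F.covDerivPairing G τ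

/-- `H` is the mean curvature `H_V` of `Φ` at `x`: the trace of the second fundamental form with
respect to the scalar product `G` on `T_x Φ`, i.e. its sum over a `G`-orthonormal basis. -/
def IsMeanCurvature (U : Set (Linf m)) (G : Linf m → LForm m) (Φ : M → Linf m) (x : M)
    (V : Linf m) (H : ℝ) : Prop :=
  ∃ II : QuadraticForm ℝ (surfTangent Φ x), IsSecondFundamentalForm U G Φ x V II ∧
    ∃ e : Module.Basis (Fin (m + 1)) ℝ (surfTangent Φ x),
      (∀ i j, G (Φ x) (e i) (e j) = if i = j then 1 else 0) ∧ H = ∑ i, II (e i)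

/-! ### Special embeddings and special metrics -/

theorem exists_gradient
    (g : Bundle.ContMDiffRiemannianMetric (𝓡 (m + 1)) ∞ (Eucl m)
      (fun x : M => TangentSpace (𝓡 (m + 1)) x)) (f : M → ℝ) (x : M) :
    ∃ w : TangentSpace (𝓡 (m + 1)) x, ∀ v : TangentSpace (𝓡 (m + 1)) x,
      g.inner x w v = mfderiv (𝓡 (m + 1)) 𝓘(ℝ, ℝ) f x v := by
  let B : Eucl m →ₗ[ℝ] Module.Dual ℝ (Eucl m) :=
    { toFun := fun w => (g.inner x w : Eucl m →L[ℝ] ℝ).toLinearMap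
      map_add' := fun a b => by
        ext v
        exact congrArg (fun l : TangentSpace (𝓡 (m + 1)) x →L[ℝ] ℝ => l v)
          ((g.inner x).map_add a b)
      map_smul' := fun c a => by
        ext v
        exact congrArg (fun l : TangentSpace (𝓡 (m + 1)) x →L[ℝ] ℝ => l v)
          ((g.inner x).map_smul c a) }
  have hinj : Function.Injective B := by
    rw [← LinearMap.ker_eq_bot, LinearMap.ker_eq_bot']
    intro w hw
    by_contra hne
    have h1 := g.pos x w hne
    have h2 : B w w = 0 := by rw [hw]; rfl
    exact absurd h2 (ne_of_gt h1)
  have hsurj : Function.Surjective B :=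
    (LinearMap.injective_iff_surjective_of_finrank_eq_finrank
      (Subspace.dual_finrank_eq (K := ℝ) (V := Eucl m)).symm).1 hinj
  obtain ⟨w, hw⟩ := hsurj
    (mfderiv (𝓡 (m + 1)) 𝓘(ℝ, ℝ) f x : Eucl m →L[ℝ] ℝ).toLinearMap
  exact ⟨w, fun v => congrArg (fun l : Module.Dual ℝ (Eucl m) => l v) hw⟩

/-- The Riemannian gradient. -/
def riemGrad
    (g : Bundle.ContMDiffRiemannianMetric (𝓡 (m + 1)) ∞ (Eucl m)
      (fun x : M => TangentSpace (𝓡 (m + 1)) x)) (f : M → ℝ) (x : M) :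
    TangentSpace (𝓡 (m + 1)) x :=
  Classical.choose (exists_gradient g f x)

/-- `A : ℝⁿ → (T_x M, g)` is a linear isometry; it restricts to an isometry `S → UT_x M`, which
transports the smooth structure and the Haar probability measure of `S` to those of `UT_x M`. -/
def IsFrame
    (g : Bundle.ContMDiffRiemannianMetric (𝓡 (m + 1)) ∞ (Eucl m)
      (fun x : M => TangentSpace (𝓡 (m + 1)) x)) (x : M)
    (A : Eucl m ≃L[ℝ] TangentSpace (𝓡 (m + 1)) x) : Prop :=
  ∀ u v : Eucl m, g.inner x (A u) (A v) = inner ℝ u v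

/-- `Φ` is a special embedding with coordinate functions `Φs`. -/
structure IsSpecialEmbedding
    (g : Bundle.ContMDiffRiemannianMetric (𝓡 (m + 1)) ∞ (Eucl m)
      (fun x : M => TangentSpace (𝓡 (m + 1)) x))
    (Φ : M → Linf m) (Φs : Sph m → M → ℝ) : Prop where
  represents : ∀ x, (Φ x : Sph m → ℝ) =ᵐ[sphereMeasure m] fun s => Φs s x
  smooth : ContMDiff ((𝓡 (m + 1)).prod (𝓡 m)) 𝓘(ℝ, ℝ) ∞ (fun p : M × Sph m => Φs p.2 p.1)
  distanceLike : ∀ s x, g.inner x (riemGrad g (Φs s) x) (riemGrad g (Φs s) x) = 1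
  /-- `s ↦ grad Φ_s(x)` is a diffeomorphism `S → UT_x M`. -/
  diffeo : ∀ (x : M) (A : Eucl m ≃L[ℝ] TangentSpace (𝓡 (m + 1)) x), IsFrame g x A →
    ∃ θ : Sph m ≃ₘ^∞⟮𝓡 m, 𝓡 m⟯ Sph m, ∀ s, A (θ s : Eucl m) = riemGrad g (Φs s) x

/-- `μ` is the measure `μ_x`: the push-forward of the Haar probability measure of `UT_x M` under
the inverse `α_x : UT_x M → S` of `s ↦ grad Φ_s(x)`.  In a linear isometry `A : ℝⁿ → T_x M`,
that inverse is `θ⁻¹ = α_x ∘ A`. -/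
def IsAlphaPushforward
    (g : Bundle.ContMDiffRiemannianMetric (𝓡 (m + 1)) ∞ (Eucl m)
      (fun x : M => TangentSpace (𝓡 (m + 1)) x))
    (Φs : Sph m → M → ℝ) (x : M) (μ : Measure (Sph m)) : Prop :=
  ∀ (A : Eucl m ≃L[ℝ] TangentSpace (𝓡 (m + 1)) x) (θ : Sph m ≃ Sph m), IsFrame g x A →
    (∀ s, A (θ s : Eucl m) = riemGrad g (Φs s) x) → μ = (sphereMeasure m).map θ.symm

/-- The measure on `S` with density `ρ`. -/
def densityMeasure (ρ : Linf m) : Measure (Sph m) :=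
  (sphereMeasure m).withDensity (fun s => ENNReal.ofReal (ρ s))

/-- `G` is special with respect to the special embedding `Φ` with coordinate functions `Φs`;
`ρ φ` is the density of the measure `ν_φ`. -/
def IsSpecialMetric
    (g : Bundle.ContMDiffRiemannianMetric (𝓡 (m + 1)) ∞ (Eucl m)
      (fun x : M => TangentSpace (𝓡 (m + 1)) x))
    (U : Set (Linf m)) (G : Linf m → LForm m) (Φ : M → Linf m) (Φs : Sph m → M → ℝ) : Prop :=
  ∃ ρ : Linf m → Linf m,
    (∀ φ ∈ U, IsProbabilityMeasure (densityMeasure (ρ φ)) ∧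
      ∀ X Y : Linf m, G φ X Y = ((m + 1 : ℕ) : ℝ) * ∫ s, X s * Y s ∂(densityMeasure (ρ φ))) ∧
    (∀ φ ∈ U, ∃ c : ℝ, 0 < c ∧ ∀ᵐ s ∂(sphereMeasure m), c ≤ ρ φ s) ∧
    ContDiffOn ℝ ∞ ρ U ∧
    ∀ x, IsAlphaPushforward g Φs x (densityMeasure (ρ (Φ x)))

end Manifold

end

/-!
The statement is local, so the manifold is replaced by the domain of a chart.  There `f` is the
immersion, `p` the projection, `D φ` the derivative of `p` at `φ`, extended to `L²`, and the metric
of the manifold is the metric `h` induced by `f`; this is the structure `LocalModel`.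

*The Jacobian.*  Let `e` be an orthonormal basis at `q₀`, and `T_k = df(e_k)` the tangent vectors at
`f q₀`.  The derivative of a projection at a point of the surface is the orthogonal projection to
the tangent space.  So the functionals `u ↦ e_k^*(d_φ p(u))` differ from `G_φ(T_k, ·)` by functionals
`δ_k φ` on `L²` that vanish at `φ = f q₀`.  The Jacobian is at least the volume expansion coefficient
on the span of the `T_k`; and it is bounded above in terms of the dual norms of the `n` functionals,
because a determinant is bounded in terms of the trace (`linearJacobian_mem_Icc`).  The second bound
contains `δ_k` only through `‖δ_k‖²` (`LocalModel.functional_bound`), so both bounds are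
differentiable at `f q₀`.  Their values there agree, hence the Jacobian, which lies in between, is
differentiable with the same derivative (`LocalModel.exists_hasFDerivAt_localJacobian`).  For the
upper bound it is, in a normal direction `V`, the trace of `e^*((D_V d p) T) - (1/2) (D_V G)(T, T)`.
The identity that `d p` is the orthogonal projection, differentiated along the surface, turns the
first term into `G(D² f, V) + (D_T G)(T, V)` (`LocalModel.second_deriv_projection`).

*The mean curvature.*  The Christoffel symbols of the metric that `G` induces on an auxiliary
submanifold are given by the derivatives of `G` and of its parametrization (`christoffel_pullback`).
Therefore `G(∇_T T̃, V)` is `G(D² f, V) + (D_T G)(T, V) - (1/2) (D_V G)(T, T)` for each of them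
(`covDerivPairing_eq`), and its trace is the derivative above.  An auxiliary submanifold exists
because the sum of `f` and of the inclusion of the line spanned by the normal vector `V` is an
immersion (`nonempty_auxSubmanifold`).

*Special metrics.*  Take orthonormal frames `a(q)` near `q₀` whose derivative at `q₀` is that of
parallel transport (`exists_torsionFree_frame`), and let `w_j = df(a ε_j) ∈ L^∞`.  For almost all
`s` the numbers `w_j(s)` are the coordinates of the gradient of `Φ_s`, so `∑ w_j² = 1`, and the
moments `∫ w_i K(w) ρ` of the measure with density `ρ` do not depend on `q`, for any polynomial `K`.
The second derivatives of `Φ_s` are symmetric, that is `∂_i w_j = ∂_j w_i`, so `w` is constant along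
its own gradient field, `∑ w_i ∂_i w_j = 0`.  Summing the derivatives of the moments leaves
`∫ K(w) R = 0` for the divergence `R = ∑ ∂_i (w_i ρ)`.  At `q₀` the `w_j` are the coordinates of a
homeomorphism of the sphere, so the functions `K(w)` are dense by the Stone–Weierstrass theorem, and
`R = 0` (`divergence_eq_zero`).  The mean curvature is `n ∫ V R - (n/2) ∫ D_V ρ`, and the second
integral vanishes as the derivative of the total mass, which is constant.
-/

noncomputable section

/-! ### Bounds for Jacobians of linear maps -/

theorem Matrix.PosSemidef.det_le_exp_trace_sub_card {ι : Type*} [Fintype ι] [DecidableEq ι]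
    {A : Matrix ι ι ℝ} (hA : A.PosSemidef) :
    A.det ≤ Real.exp (A.trace - Fintype.card ι) := by
  have h1 : A.det = ∏ i, hA.1.eigenvalues i := by
    simpa using hA.1.det_eq_prod_eigenvalues
  have h2 : A.trace = ∑ i, hA.1.eigenvalues i := by
    simpa using hA.1.trace_eq_sum_eigenvalues
  have h3 : A.trace - Fintype.card ι = ∑ i, (hA.1.eigenvalues i - 1) := by
    simp [h2]
  rw [h1, h3, Real.exp_sum]
  refine Finset.prod_le_prod (fun i _ => hA.eigenvalues_nonneg i) fun i _ => ?_
  have := Real.add_one_le_exp (hA.1.eigenvalues i - 1)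
  linarith

theorem posDef_gram {E ι : Type*} [AddCommGroup E] [Module ℝ E] [Fintype ι]
    {B : E →ₗ[ℝ] E →ₗ[ℝ] ℝ} (hs : ∀ u v, B u v = B v u) (hp : ∀ u, u ≠ 0 → 0 < B u u)
    {b : ι → E} (hb : LinearIndependent ℝ b) :
    (Matrix.of fun i j => B (b i) (b j)).PosDef := by
  refine Matrix.PosDef.of_dotProduct_mulVec_pos ?_ ?_
  · ext i j
    simp [hs (b i) (b j)]
  · intro x hx
    have h0 : ∑ i, x i • b i ≠ 0 := by
      intro h
      exact hx (funext (Fintype.linearIndependent_iff.1 hb x h))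
    have := hp _ h0
    simp only [map_sum, LinearMap.sum_apply, map_smul, LinearMap.smul_apply, smul_eq_mul] at this
    refine this.trans_eq ?_
    simp only [Matrix.mulVec, dotProduct, Finset.mul_sum, Matrix.of_apply, Pi.star_apply,
      star_trivial]
    refine Finset.sum_congr rfl fun i _ => Finset.sum_congr rfl fun j _ => ?_
    rw [hs (b j)]
    ring

theorem det_pullback_gram {E X ι : Type*} [AddCommGroup E] [Module ℝ E]
    [AddCommGroup X] [Module ℝ X] [Fintype ι] [DecidableEq ι]
    (h : X →ₗ[ℝ] X →ₗ[ℝ] ℝ) (e : Module.Basis ι ℝ X) (L : E → X) (b : ι → E) :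
    (Matrix.of fun i j => h (L (b i)) (L (b j))).det =
      (Matrix.of fun i j => h (e i) (e j)).det *
        (Matrix.of fun k i => e.repr (L (b i)) k).det ^ 2 := by
  have : (Matrix.of fun i j => h (L (b i)) (L (b j))) =
      (Matrix.of fun k i => e.repr (L (b i)) k).transpose *
        (Matrix.of fun i j => h (e i) (e j)) * (Matrix.of fun k i => e.repr (L (b i)) k) := by
    ext i j
    conv_lhs => rw [Matrix.of_apply, ← e.sum_repr (L (b i)), ← e.sum_repr (L (b j))]
    simp only [map_sum, LinearMap.sum_apply, map_smul, LinearMap.smul_apply, smul_eq_mul,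
      Matrix.mul_apply, Matrix.transpose_apply, Matrix.of_apply, Finset.sum_mul]
    refine Finset.sum_congr rfl fun k _ => ?_
    rw [Finset.mul_sum]
    refine Finset.sum_congr rfl fun l _ => by ring
  rw [this, Matrix.det_mul, Matrix.det_mul, Matrix.det_transpose]
  ring

/-- An upper bound for all the volume expansion coefficients at once.  By the bound `hL`, the trace
of the Gram matrix of the functionals `e_k^* ∘ L`, restricted to `Y`, is at most `∑ t k`; the
determinant of that matrix is bounded in terms of its trace. -/
theorem jacobianOn_le {E X : Type*} [AddCommGroup E] [Module ℝ E]
    [AddCommGroup X] [Module ℝ X] {n : ℕ} {B : E →ₗ[ℝ] E →ₗ[ℝ] ℝ}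
    (hs : ∀ u v, B u v = B v u) (hp : ∀ u, u ≠ 0 → 0 < B u u)
    (h : X →ₗ[ℝ] X →ₗ[ℝ] ℝ) (e : Module.Basis (Fin n) ℝ X)
    (hdet : 0 ≤ (Matrix.of fun i j => h (e i) (e j)).det) (L : E →ₗ[ℝ] X) {t : Fin n → ℝ}
    (hL : ∀ k u, 2 * e.repr (L u) k - B u u ≤ t k)
    {Y : Submodule ℝ E} (b : Module.Basis (Fin n) ℝ Y) :
    jacobianOn (fun u v => B u v) (fun v w => h v w) L b ≤
      √((Matrix.of fun i j => h (e i) (e j)).det) * Real.exp ((∑ k, t k - n) / 2) := by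
  set b' : Fin n → E := fun i => (b i : E) with hb'
  have hbi : LinearIndependent ℝ b' := b.linearIndependent.map' Y.subtype (by simp)
  have hG := posDef_gram hs hp hbi
  set Gm : Matrix (Fin n) (Fin n) ℝ := Matrix.of fun i j => B (b' i) (b' j) with hGm
  set C : Matrix (Fin n) (Fin n) ℝ := Matrix.of fun k i => e.repr (L (b' i)) k with hC
  have hu : IsUnit Gm.det := hG.det_pos.ne'.isUnit
  have hS : (C * Gm⁻¹ * C.transpose).PosSemidef := by
    simpa using hG.inv.posSemidef.mul_mul_conjTranspose_same C
  have hdetS : (C * Gm⁻¹ * C.transpose).det = C.det ^ 2 / Gm.det := by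
    rw [Matrix.det_mul, Matrix.det_mul, Matrix.det_transpose, Matrix.det_nonsing_inv,
      Ring.inverse_eq_inv]
    ring
  have htr : (C * Gm⁻¹ * C.transpose).trace ≤ ∑ k, t k := by
    refine Finset.sum_le_sum fun k _ => ?_
    set z : Fin n → ℝ := Gm⁻¹.mulVec (C k) with hz
    have hz2 : Gm.mulVec z = C k := by
      rw [hz, Matrix.mulVec_mulVec, Matrix.mul_nonsing_inv _ hu, Matrix.one_mulVec]
    have h1 : (C * Gm⁻¹ * C.transpose) k k = dotProduct (C k) z := by
      rw [Matrix.mul_assoc, Matrix.mul_apply]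
      refine Finset.sum_congr rfl fun i _ => ?_
      simp [hz, Matrix.mulVec, dotProduct, Matrix.mul_apply]
    have h2 : e.repr (L (∑ i, z i • b' i)) k = dotProduct (C k) z := by
      simp [map_sum, dotProduct, hC, mul_comm]
    have h3 : B (∑ i, z i • b' i) (∑ i, z i • b' i) = dotProduct (C k) z := by
      rw [← hz2]
      simp only [map_sum, LinearMap.sum_apply, map_smul, LinearMap.smul_apply, smul_eq_mul,
        Matrix.mulVec, dotProduct, Finset.sum_mul, Finset.mul_sum, Matrix.of_apply, hGm]
      refine Finset.sum_congr rfl fun i _ => Finset.sum_congr rfl fun j _ => ?_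
      rw [hs (b' j)]
      ring
    have := hL k (∑ i, z i • b' i)
    rw [h2, h3] at this
    rw [Matrix.diag_apply, h1]
    linarith
  have hle : C.det ^ 2 / Gm.det ≤ Real.exp (∑ k, t k - n) := by
    rw [← hdetS]
    refine hS.det_le_exp_trace_sub_card.trans (Real.exp_le_exp.2 ?_)
    simpa using htr
  unfold jacobianOn
  have e1 := det_pullback_gram h e L b'
  rw [show (Matrix.of fun i j => h (L (b i)) (L (b j))).det = _ from e1,
    mul_div_assoc, Real.sqrt_mul hdet]
  refine mul_le_mul_of_nonneg_left ?_ (Real.sqrt_nonneg _)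
  rw [Real.exp_half]
  exact Real.sqrt_le_sqrt hle

theorem linearJacobian_congr {E X X' : Type*} [AddCommGroup E] [Module ℝ E] {n : ℕ}
    {B : E → E → ℝ} {h : X → X → ℝ} {h' : X' → X' → ℝ} {L : E → X} {L' : E → X'}
    (H : ∀ u v, h (L u) (L v) = h' (L' u) (L' v)) :
    linearJacobian n B h L = linearJacobian n B h' L' := by
  simp only [linearJacobian, jacobianOn, H]

/-- The Jacobian lies between the volume expansion coefficient of the span of `T` and the bound of
`jacobianOn_le`. -/
theorem linearJacobian_mem_Icc {E X : Type*} [AddCommGroup E] [Module ℝ E]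
    [AddCommGroup X] [Module ℝ X] {n : ℕ} {B : E →ₗ[ℝ] E →ₗ[ℝ] ℝ}
    (hs : ∀ u v, B u v = B v u) (hp : ∀ u, u ≠ 0 → 0 < B u u)
    (h : X →ₗ[ℝ] X →ₗ[ℝ] ℝ) (e : Module.Basis (Fin n) ℝ X)
    (hdet : 0 ≤ (Matrix.of fun i j => h (e i) (e j)).det) (L : E →ₗ[ℝ] X) {t : Fin n → ℝ}
    (hL : ∀ k u, 2 * e.repr (L u) k - B u u ≤ t k)
    {T : Fin n → E} (hT : LinearIndependent ℝ T) :
    √((Matrix.of fun i j => h (L (T i)) (L (T j))).det /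
        (Matrix.of fun i j => B (T i) (T j)).det) ≤
      linearJacobian n (fun u v => B u v) (fun v w => h v w) L ∧
    linearJacobian n (fun u v => B u v) (fun v w => h v w) L ≤
      √((Matrix.of fun i j => h (e i) (e j)).det) * Real.exp ((∑ k, t k - n) / 2) := by
  have hmem : √((Matrix.of fun i j => h (L (T i)) (L (T j))).det /
      (Matrix.of fun i j => B (T i) (T j)).det) ∈
      {j | ∃ (Y : Submodule ℝ E) (b : Module.Basis (Fin n) ℝ Y),
        j = jacobianOn (fun u v => B u v) (fun v w => h v w) L b} := by
    refine ⟨_, Module.Basis.span hT, ?_⟩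
    simp only [jacobianOn, Module.Basis.span_apply]
  have hub : ∀ j ∈ {j | ∃ (Y : Submodule ℝ E) (b : Module.Basis (Fin n) ℝ Y),
        j = jacobianOn (fun u v => B u v) (fun v w => h v w) L b},
      j ≤ √((Matrix.of fun i j => h (e i) (e j)).det) * Real.exp ((∑ k, t k - n) / 2) := by
    rintro j ⟨Y, b, rfl⟩
    exact jacobianOn_le hs hp h e hdet L hL b
  exact ⟨le_csSup ⟨_, hub⟩ hmem, csSup_le ⟨_, hmem⟩ hub⟩

/-- A function squeezed between two differentiable functions that agree with it at a point is
differentiable there, with the derivative of the upper bound. -/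
theorem HasFDerivAt.of_squeeze {E : Type*} [NormedAddCommGroup E] [NormedSpace ℝ E]
    {l J u : E → ℝ} {x : E} {u' : E →L[ℝ] ℝ} (hl : DifferentiableAt ℝ l x)
    (hu : HasFDerivAt u u' x) (hlJ : ∀ᶠ y in 𝓝 x, l y ≤ J y) (hJu : ∀ᶠ y in 𝓝 x, J y ≤ u y)
    (hx : l x = u x) : HasFDerivAt J u' x := by
  have hJx : J x = u x := le_antisymm hJu.self_of_nhds (hx ▸ hlJ.self_of_nhds)
  have hl' : HasFDerivAt l u' x := by
    have hmin : IsLocalMin (fun y => u y - l y) x := by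
      filter_upwards [hlJ, hJu] with y h1 h2
      rw [hx, sub_self]
      linarith
    have := hmin.hasFDerivAt_eq_zero (hu.sub hl.hasFDerivAt)
    rw [sub_eq_zero] at this
    rw [this]
    exact hl.hasFDerivAt
  rw [hasFDerivAt_iff_isLittleO] at hu hl' ⊢
  have hsum := hl'.abs_left.add hu.abs_left
  refine Asymptotics.IsBigO.trans_isLittleO (Asymptotics.IsBigO.of_bound 1 ?_) hsum
  filter_upwards [hlJ, hJu] with y h1 h2
  rw [one_mul, Real.norm_eq_abs, Real.norm_eq_abs, hJx, hx]
  refine le_trans ?_ (le_abs_self _)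
  rw [abs_le]
  constructor
  · have := neg_abs_le (l y - u x - u' (y - x))
    have := abs_nonneg (u y - u x - u' (y - x))
    linarith
  · have := le_abs_self (u y - u x - u' (y - x))
    have := abs_nonneg (l y - u x - u' (y - x))
    linarith

/-! ### The inclusion of `L^∞` into `L²` -/

theorem two_le_smooth : (2 : WithTop ℕ∞) ≤ ∞ :=
  WithTop.coe_le_coe.2 (le_top (a := (2 : ℕ∞)))

theorem norm_toL2_le (m : ℕ) (u : Linf m) : ‖toL2 m u‖ ≤ ‖u‖ := by
  rw [Lp.norm_def, Lp.norm_def]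
  refine ENNReal.toReal_mono (Lp.eLpNorm_ne_top u) ?_
  exact eLpNorm_le_eLpNorm_of_exponent_le le_top (Lp.aestronglyMeasurable u)

theorem toL2_injective (m : ℕ) : Function.Injective (toL2 m) := by
  intro u v h
  have : (toL2 m u).1 = (toL2 m v).1 := congrArg Subtype.val h
  exact Subtype.ext this

/-- The inclusion of `L^∞` into `L²` as a continuous linear map. -/
def toL2L (m : ℕ) : Linf m →L[ℝ] Ltwo m :=
  (toL2 m).mkContinuous 1 fun u => by simpa using norm_toL2_le m u

@[simp] theorem toL2L_apply (m : ℕ) (u : Linf m) : toL2L m u = toL2 m u := rfl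

theorem denseRange_toL2 (m : ℕ) : DenseRange (toL2 m) := by
  have h := Lp.simpleFunc.denseRange (E := ℝ) (μ := sphereMeasure m) (p := 2) (by simp)
  refine h.mono ?_
  rintro _ ⟨s, rfl⟩
  have hmem : MemLp (Lp.simpleFunc.toSimpleFunc s) ⊤ (sphereMeasure m) :=
    SimpleFunc.memLp_top _ _
  refine ⟨hmem.toLp _, ?_⟩
  refine Lp.ext ?_
  have h1 : (toL2 m (hmem.toLp _) : Sph m → ℝ) =ᵐ[sphereMeasure m]
      Lp.simpleFunc.toSimpleFunc s := hmem.coeFn_toLp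
  exact h1.trans (Lp.simpleFunc.toSimpleFunc_eq_toFun s)

/-- The restriction of a bounded bilinear form on `L²` to `L^∞`. -/
def restrictForm {m : ℕ} (B : Ltwo m →L[ℝ] Ltwo m →L[ℝ] ℝ) : Linf m →L[ℝ] Linf m →L[ℝ] ℝ :=
  (ContinuousLinearMap.precomp ℝ (toL2L m)) ∘L (B ∘L toL2L m)

@[simp] theorem restrictForm_apply {m : ℕ} (B : Ltwo m →L[ℝ] Ltwo m →L[ℝ] ℝ) (u v : Linf m) :
    restrictForm B u v = B (toL2 m u) (toL2 m v) := rfl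

theorem ContDiffAt.restrictForm {m : ℕ} {n : WithTop ℕ∞}
    {Gt : Linf m → Ltwo m →L[ℝ] Ltwo m →L[ℝ] ℝ} {φ : Linf m} (h : ContDiffAt ℝ n Gt φ) :
    ContDiffAt ℝ n (fun ψ => restrictForm (Gt ψ)) φ :=
  contDiffAt_const.clm_comp (h.clm_comp contDiffAt_const)

theorem IsScalarProduct.pos {m : ℕ} {B : LForm m} (hB : IsScalarProduct B) {u : Linf m}
    (hu : u ≠ 0) : 0 < B u u := by
  obtain ⟨c, hc, C, hC, h⟩ := hB.compatible
  have : toL2 m u ≠ 0 := fun h0 => hu (toL2_injective m (by rw [h0, map_zero]))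
  exact lt_of_lt_of_le (mul_pos hc (pow_pos (norm_pos_iff.2 this) 2)) (h u).1

/-! ### Isometric immersions and projections in local coordinates -/

/-- An isometric immersion `f` and a projection `p`, both read in a chart of the manifold, near the
point `q₀` of the chart.  `Gt` is the extension of the metric `G` to `L²`, and `D` that of the
derivative of `p`; the metric of the manifold is the pull-back of `G` under `f`. -/
structure LocalModel {m : ℕ} (G : Linf m → LForm m) (Gt : Linf m → Ltwo m →L[ℝ] Ltwo m →L[ℝ] ℝ)
    (f : Eucl m → Linf m) (p : Linf m → Eucl m) (D : Linf m → Ltwo m →L[ℝ] Eucl m)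
    (q₀ : Eucl m) : Prop where
  metric_smooth : ContDiffAt ℝ ∞ Gt (f q₀)
  metric_eq : ∀ᶠ φ in 𝓝 (f q₀), ∀ u v, Gt φ (toL2 m u) (toL2 m v) = G φ u v
  scalar : ∀ᶠ φ in 𝓝 (f q₀), IsScalarProduct (G φ)
  immersion_smooth : ContDiffAt ℝ ∞ f q₀
  deriv_smooth : ContDiffAt ℝ ∞ D (f q₀)
  hasFDerivAt : ∀ᶠ φ in 𝓝 (f q₀), HasFDerivAt p (D φ ∘L toL2L m) φ
  retraction : ∀ᶠ q in 𝓝 q₀, p (f q) = q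
  normal : ∀ᶠ q in 𝓝 q₀, ∀ V, (∀ v, G (f q) (fderiv ℝ f q v) V = 0) → D (f q) (toL2 m V) = 0

/-- The metric on `X` induced by the map `f : X → 𝓛`, at the point `q`. -/
def inducedMetric {m : ℕ} (Gt : Linf m → Ltwo m →L[ℝ] Ltwo m →L[ℝ] ℝ) (f : Eucl m → Linf m)
    (q : Eucl m) : Eucl m →L[ℝ] Eucl m →L[ℝ] ℝ :=
  (restrictForm (Gt (f q))).bilinearComp (fderiv ℝ f q) (fderiv ℝ f q)

theorem inducedMetric_apply {m : ℕ} (Gt : Linf m → Ltwo m →L[ℝ] Ltwo m →L[ℝ] ℝ)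
    (f : Eucl m → Linf m) (q v w : Eucl m) : inducedMetric Gt f q v w =
      restrictForm (Gt (f q)) (fderiv ℝ f q v) (fderiv ℝ f q w) := rfl

/-- The second fundamental form of `f` at `q` in the direction `V`, as a bilinear form:
`G(D²f(v, w), V) + D_{df v} G (df w, V) - (1/2) D_V G (df v, df w)`. -/
def localSecondForm {m : ℕ} (Gt : Linf m → Ltwo m →L[ℝ] Ltwo m →L[ℝ] ℝ) (f : Eucl m → Linf m)
    (q : Eucl m) (V : Linf m) (v w : Eucl m) : ℝ :=
  restrictForm (Gt (f q)) (fderiv ℝ (fderiv ℝ f) q v w) V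
    + fderiv ℝ (fun φ => restrictForm (Gt φ)) (f q) (fderiv ℝ f q v) (fderiv ℝ f q w) V
    - (1 / 2) * fderiv ℝ (fun φ => restrictForm (Gt φ)) (f q) V (fderiv ℝ f q v) (fderiv ℝ f q w)

theorem HasFDerivAt.clm_apply₂ {X E : Type*} [NormedAddCommGroup X] [NormedSpace ℝ X]
    [NormedAddCommGroup E] [NormedSpace ℝ E] {k : X → E →L[ℝ] E →L[ℝ] ℝ} {a b : X → E}
    {k' : X →L[ℝ] E →L[ℝ] E →L[ℝ] ℝ} {a' b' : X →L[ℝ] E} {q : X} (hk : HasFDerivAt k k' q)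
    (ha : HasFDerivAt a a' q) (hb : HasFDerivAt b b' q) :
    ∃ d : X →L[ℝ] ℝ, HasFDerivAt (fun x => k x (a x) (b x)) d q ∧
      ∀ v, d v = k' v (a q) (b q) + k q (a' v) (b q) + k q (a q) (b' v) := by
  refine ⟨_, (hk.clm_apply ha).clm_apply hb, fun v => ?_⟩
  simp
  ring

namespace LocalModel

variable {m : ℕ} {G : Linf m → LForm m} {Gt : Linf m → Ltwo m →L[ℝ] Ltwo m →L[ℝ] ℝ}
  {f : Eucl m → Linf m} {p : Linf m → Eucl m} {D : Linf m → Ltwo m →L[ℝ] Eucl m} {q₀ : Eucl m}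

theorem tendsto (H : LocalModel G Gt f p D q₀) : Tendsto f (𝓝 q₀) (𝓝 (f q₀)) :=
  H.immersion_smooth.continuousAt

theorem eventually_differentiableAt (H : LocalModel G Gt f p D q₀) :
    ∀ᶠ q in 𝓝 q₀, DifferentiableAt ℝ f q := by
  filter_upwards [(H.immersion_smooth.of_le (m := 1) (by exact_mod_cast le_top)).eventually
    (by simp)] with q hq
  exact hq.differentiableAt (by simp)

theorem hasFDerivAt_fderiv (H : LocalModel G Gt f p D q₀) :
    HasFDerivAt (fderiv ℝ f) (fderiv ℝ (fderiv ℝ f) q₀) q₀ :=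
  ((H.immersion_smooth.fderiv_right (m := 1) two_le_smooth).differentiableAt
    (by simp)).hasFDerivAt

theorem second_deriv_symm (H : LocalModel G Gt f p D q₀) (v w : Eucl m) :
    fderiv ℝ (fderiv ℝ f) q₀ v w = fderiv ℝ (fderiv ℝ f) q₀ w v :=
  (H.immersion_smooth.isSymmSndFDerivAt (by simpa using two_le_smooth)).eq v w

theorem hasFDerivAt_metric (H : LocalModel G Gt f p D q₀) :
    HasFDerivAt (fun φ => restrictForm (Gt φ))
      (fderiv ℝ (fun φ => restrictForm (Gt φ)) (f q₀)) (f q₀) :=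
  (H.metric_smooth.restrictForm.differentiableAt (by simp)).hasFDerivAt

theorem hasFDerivAt_metric_comp (H : LocalModel G Gt f p D q₀) :
    HasFDerivAt (fun q => restrictForm (Gt (f q)))
      ((fderiv ℝ (fun φ => restrictForm (Gt φ)) (f q₀)) ∘L fderiv ℝ f q₀) q₀ :=
  HasFDerivAt.comp (g := fun φ => restrictForm (Gt φ)) q₀ H.hasFDerivAt_metric
    H.eventually_differentiableAt.self_of_nhds.hasFDerivAt

/-- `d_{f(q)} p` is a left inverse of `d_q f`. -/
theorem leftInverse (H : LocalModel G Gt f p D q₀) :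
    ∀ᶠ q in 𝓝 q₀, ∀ v, D (f q) (toL2 m (fderiv ℝ f q v)) = v := by
  filter_upwards [H.retraction.eventually_nhds, H.eventually_differentiableAt,
    H.tendsto.eventually H.hasFDerivAt] with q h1 h2 h3 v
  have h4 := h3.comp q h2.hasFDerivAt
  have h5 : HasFDerivAt (p ∘ f) (ContinuousLinearMap.id ℝ (Eucl m)) q :=
    (hasFDerivAt_id q).congr_of_eventuallyEq h1
  exact congrArg (fun A : Eucl m →L[ℝ] Eucl m => A v) (h4.unique h5)

/-- The vectors `d_{f(q)} p(V)` and `V` have the same products with tangent vectors: the derivative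
of a projection is the orthogonal projection to the tangent space. -/
theorem pairing (H : LocalModel G Gt f p D q₀) :
    ∀ᶠ q in 𝓝 q₀, ∀ V w, inducedMetric Gt f q (D (f q) (toL2 m V)) w =
      restrictForm (Gt (f q)) V (fderiv ℝ f q w) := by
  filter_upwards [H.leftInverse, H.normal, H.tendsto.eventually H.metric_eq,
    H.tendsto.eventually H.scalar] with q h1 h2 h3 h4 V w
  let B : Eucl m →ₗ[ℝ] Module.Dual ℝ (Eucl m) :=
    (ContinuousLinearMap.coeLM ℝ).comp (inducedMetric Gt f q).toLinearMap
  have hB : ∀ u v, B u v = G (f q) (fderiv ℝ f q u) (fderiv ℝ f q v) := fun u v => h3 _ _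
  have hinj : Function.Injective B := by
    rw [← LinearMap.ker_eq_bot, LinearMap.ker_eq_bot']
    intro u hu
    by_contra hne
    have hd : fderiv ℝ f q u ≠ 0 := by
      intro h0
      apply hne
      rw [← h1 u, h0, map_zero, map_zero]
    have := h4.pos hd
    rw [← hB, hu] at this
    simp at this
  have hsurj : Function.Surjective B :=
    (LinearMap.injective_iff_surjective_of_finrank_eq_finrank
      (Subspace.dual_finrank_eq (K := ℝ) (V := Eucl m)).symm).1 hinj
  obtain ⟨w₀, hw₀⟩ := hsurj
    ((restrictForm (Gt (f q)) V) ∘L fderiv ℝ f q : Eucl m →L[ℝ] ℝ).toLinearMap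
  have key : ∀ v, B w₀ v = G (f q) V (fderiv ℝ f q v) := fun v =>
    (congrArg (fun l : Module.Dual ℝ (Eucl m) => l v) hw₀).trans (h3 _ _)
  have hn : D (f q) (toL2 m (V - fderiv ℝ f q w₀)) = 0 := by
    refine h2 _ fun v => ?_
    rw [h4.symm, map_sub, LinearMap.sub_apply, ← key, ← hB, sub_self]
  rw [map_sub, map_sub, h1, sub_eq_zero] at hn
  rw [hn]
  exact (key w).trans (h3 _ _).symm

theorem second_deriv_projection_symm (H : LocalModel G Gt f p D q₀) (u v : Linf m) :
    fderiv ℝ D (f q₀) u (toL2 m v) = fderiv ℝ D (f q₀) v (toL2 m u) := by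
  have hD : HasFDerivAt D (fderiv ℝ D (f q₀)) (f q₀) :=
    (H.deriv_smooth.differentiableAt (by simp)).hasFDerivAt
  have h2 : HasFDerivAt (fun φ => D φ ∘L toL2L m)
      ((ContinuousLinearMap.precomp (Eucl m) (toL2L m)) ∘L fderiv ℝ D (f q₀)) (f q₀) :=
    HasFDerivAt.comp (g := ContinuousLinearMap.precomp (Eucl m) (toL2L m)) (f q₀)
      (ContinuousLinearMap.hasFDerivAt _) hD
  exact second_derivative_symmetric_of_eventually H.hasFDerivAt h2 u v

/-- The second derivative of the projection in a normal direction is given by the second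
fundamental form: this is the derivative of the identity `pairing` along the surface. -/
theorem second_deriv_projection (H : LocalModel G Gt f p D q₀) {V : Linf m}
    (hV : ∀ v, restrictForm (Gt (f q₀)) (fderiv ℝ f q₀ v) V = 0) (v w : Eucl m) :
    inducedMetric Gt f q₀ (fderiv ℝ D (f q₀) V (toL2 m (fderiv ℝ f q₀ v))) w =
      restrictForm (Gt (f q₀)) (fderiv ℝ (fderiv ℝ f) q₀ v w) V
      + fderiv ℝ (fun φ => restrictForm (Gt φ)) (f q₀) (fderiv ℝ f q₀ v) (fderiv ℝ f q₀ w) V := by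
  have hf := H.eventually_differentiableAt.self_of_nhds.hasFDerivAt
  have hsymm : ∀ᶠ φ in 𝓝 (f q₀), ∀ a b, restrictForm (Gt φ) a b = restrictForm (Gt φ) b a := by
    filter_upwards [H.metric_eq, H.scalar] with φ h1 h2 a b
    rw [restrictForm_apply, restrictForm_apply, h1, h1, h2.symm]
  have hDV : D (f q₀) (toL2 m V) = 0 := by
    refine H.normal.self_of_nhds V fun v => ?_
    rw [← H.metric_eq.self_of_nhds]
    exact hV v
  have hD : HasFDerivAt (fun q => D (f q) (toL2 m V)) _ q₀ :=
    ((HasFDerivAt.comp q₀ (H.deriv_smooth.differentiableAt (by simp)).hasFDerivAt hf).clm_apply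
      (hasFDerivAt_const (toL2 m V) q₀))
  have hdfw : ∀ w, HasFDerivAt (fun q => fderiv ℝ f q w) _ q₀ := fun w =>
    H.hasFDerivAt_fderiv.clm_apply (hasFDerivAt_const w q₀)
  have hL1 : HasFDerivAt (fun q => fderiv ℝ f q (D (f q) (toL2 m V))) _ q₀ :=
    H.hasFDerivAt_fderiv.clm_apply hD
  obtain ⟨d1, hd1, e1⟩ := H.hasFDerivAt_metric_comp.clm_apply₂ hL1 (hdfw w)
  obtain ⟨d2, hd2, e2⟩ := H.hasFDerivAt_metric_comp.clm_apply₂ (hdfw w)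
    (hasFDerivAt_const V q₀)
  have heq : (fun q => restrictForm (Gt (f q)) (fderiv ℝ f q (D (f q) (toL2 m V)))
      (fderiv ℝ f q w)) =ᶠ[𝓝 q₀] fun q => restrictForm (Gt (f q)) (fderiv ℝ f q w) V := by
    filter_upwards [H.pairing, H.tendsto.eventually hsymm] with q h1 h2
    rw [h2 _ V]
    exact h1 V w
  have hd12 : d1 = d2 := hd1.unique (hd2.congr_of_eventuallyEq heq)
  have := congrArg (fun A : Eucl m →L[ℝ] ℝ => A v) hd12
  simp only [e1, e2] at this
  simp [hDV] at this
  rw [inducedMetric_apply, H.second_deriv_projection_symm]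
  simp only [restrictForm_apply]
  rw [this]
  ring

end LocalModel

/-! ### The derivative of the Jacobian in local coordinates -/

theorem differentiableAt_det {E ι : Type*} [NormedAddCommGroup E] [NormedSpace ℝ E] [Fintype ι]
    [DecidableEq ι] {A : E → ι → ι → ℝ} {x : E} (h : ∀ i j, DifferentiableAt ℝ (fun y => A y i j) x) :
    DifferentiableAt ℝ (fun y => (Matrix.of (A y)).det) x := by
  simp only [Matrix.det_apply, Matrix.of_apply]
  refine DifferentiableAt.fun_sum fun σ _ => ?_
  refine DifferentiableAt.const_smul ?_ _
  exact (HasFDerivAt.finsetProd fun i _ => (h (σ i) i).hasFDerivAt).differentiableAt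

theorem hasFDerivAt_norm_sq_of_eq_zero {E F : Type*} [NormedAddCommGroup E] [NormedSpace ℝ E]
    [NormedAddCommGroup F] [NormedSpace ℝ F] {δ : E → F} {x : E} (h : DifferentiableAt ℝ δ x)
    (h0 : δ x = 0) : HasFDerivAt (fun y => ‖δ y‖ ^ 2) (0 : E →L[ℝ] ℝ) x := by
  have h1 : δ =O[𝓝 x] fun y => y - x := by
    simpa [h0] using h.isBigO_sub
  exact Asymptotics.IsBigO.hasFDerivAt (h1.norm_norm.pow 2) one_lt_two

namespace LocalModel

variable {m : ℕ} {G : Linf m → LForm m} {Gt : Linf m → Ltwo m →L[ℝ] Ltwo m →L[ℝ] ℝ}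
  {f : Eucl m → Linf m} {p : Linf m → Eucl m} {D : Linf m → Ltwo m →L[ℝ] Eucl m} {q₀ : Eucl m}

theorem projection_apply (H : LocalModel G Gt f p D q₀) : p (f q₀) = q₀ :=
  H.retraction.self_of_nhds

theorem form_symm (H : LocalModel G Gt f p D q₀) :
    ∀ᶠ φ in 𝓝 (f q₀), ∀ a b, restrictForm (Gt φ) a b = restrictForm (Gt φ) b a := by
  filter_upwards [H.metric_eq, H.scalar] with φ h1 h2 a b
  rw [restrictForm_apply, restrictForm_apply, h1, h1, h2.symm]

/-- The scalar products `G φ` are uniformly coercive for `φ` near `f q₀`. -/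
theorem coercive (H : LocalModel G Gt f p D q₀) :
    ∃ c > 0, ∀ᶠ φ in 𝓝 (f q₀), ∀ u, c * ‖toL2 m u‖ ^ 2 ≤ restrictForm (Gt φ) u u := by
  obtain ⟨c, hc, C, hC, h⟩ := H.scalar.self_of_nhds.compatible
  refine ⟨c / 2, half_pos hc, ?_⟩
  filter_upwards [H.metric_smooth.continuousAt.eventually (Metric.ball_mem_nhds _ (half_pos hc))]
    with φ hφ u
  rw [dist_eq_norm] at hφ
  have h1 := (h u).1
  rw [← H.metric_eq.self_of_nhds] at h1
  have h2 := (Gt φ - Gt (f q₀)).le_opNorm₂ (toL2 m u) (toL2 m u)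
  have h3 : ‖Gt φ - Gt (f q₀)‖ * ‖toL2 m u‖ * ‖toL2 m u‖ ≤ c / 2 * ‖toL2 m u‖ * ‖toL2 m u‖ := by
    gcongr
  have h4 := (abs_le.1 (h2.trans h3)).1
  simp only [sub_apply] at h4
  rw [restrictForm_apply]
  nlinarith

/-- The functional `L_φ(u) = e_k^*(d_φ p(u))` exceeds `G_φ(T, u)` by `δ_φ`; completing the square
bounds its dual norm. -/
theorem functional_bound {c : ℝ} (hc : 0 < c) {B : Ltwo m →L[ℝ] Ltwo m →L[ℝ] ℝ}
    (hs : ∀ a b, restrictForm B a b = restrictForm B b a)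
    (hB : ∀ u, c * ‖toL2 m u‖ ^ 2 ≤ restrictForm B u u) (ℓ : Ltwo m →L[ℝ] ℝ) (T u : Linf m) :
    2 * ℓ (toL2 m u) - restrictForm B u u ≤
      2 * ℓ (toL2 m T) - restrictForm B T T + c⁻¹ * ‖ℓ - B (toL2 m T)‖ ^ 2 := by
  have h1 := hB (u - T)
  simp only [map_sub, sub_apply] at h1
  rw [hs u T, ← map_sub] at h1
  have h2 := (abs_le.1 ((ℓ - B (toL2 m T)).le_opNorm (toL2 m (u - T)))).2
  simp only [map_sub, sub_apply] at h2
  rw [← map_sub, ← restrictForm_apply, ← restrictForm_apply] at h2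
  set a := ‖ℓ - B (toL2 m T)‖
  set b := ‖toL2 m (u - T)‖
  have h3 : 2 * (a * b) ≤ c * b ^ 2 + c⁻¹ * a ^ 2 := by
    have : c * b ^ 2 + c⁻¹ * a ^ 2 - 2 * (a * b) = c⁻¹ * (c * b - a) ^ 2 := by
      field_simp
      ring
    have h4 : 0 ≤ c⁻¹ * (c * b - a) ^ 2 := by positivity
    linarith
  linarith

theorem repr_eq {e : Module.Basis (Fin (m + 1)) ℝ (Eucl m)} {h : Eucl m →L[ℝ] Eucl m →L[ℝ] ℝ}
    (he : ∀ i j, h (e i) (e j) = if i = j then 1 else 0) (w : Eucl m) (k : Fin (m + 1)) :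
    e.repr w k = h w (e k) := by
  conv_rhs => rw [← e.sum_repr w]
  simp only [map_sum, map_smul, sum_apply, smul_apply, he]
  simp

/-- The Jacobian of the projection, in local coordinates. -/
def localJacobian (G : Linf m → LForm m) (Gt : Linf m → Ltwo m →L[ℝ] Ltwo m →L[ℝ] ℝ)
    (f : Eucl m → Linf m) (p : Linf m → Eucl m) (D : Linf m → Ltwo m →L[ℝ] Eucl m)
    (φ : Linf m) : ℝ :=
  linearJacobian (m + 1) (fun u v => G φ u v) (fun v w => inducedMetric Gt f (p φ) v w)
    (fun u => D φ (toL2 m u))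

theorem differentiableAt_inducedMetric_apply (H : LocalModel G Gt f p D q₀) {E : Type*}
    [NormedAddCommGroup E] [NormedSpace ℝ E] {r : E → Eucl m} {a b : E → Eucl m} {x : E}
    (hx : r x = q₀) (hr : DifferentiableAt ℝ r x)
    (ha : DifferentiableAt ℝ a x) (hb : DifferentiableAt ℝ b x) :
    DifferentiableAt ℝ (fun y => inducedMetric Gt f (r y) (a y) (b y)) x := by
  subst hx
  have h1 : DifferentiableAt ℝ (fun y => restrictForm (Gt (f (r y)))) x :=
    DifferentiableAt.comp (g := fun q => restrictForm (Gt (f q))) x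
      H.hasFDerivAt_metric_comp.differentiableAt hr
  have h2 : DifferentiableAt ℝ (fun y => fderiv ℝ f (r y)) x :=
    DifferentiableAt.comp (g := fderiv ℝ f) x H.hasFDerivAt_fderiv.differentiableAt hr
  exact (h1.clm_apply (h2.clm_apply ha)).clm_apply (h2.clm_apply hb)

/-- The derivative of the Jacobian of the projection at a point of the surface, in a normal
direction, is the trace of the second fundamental form. -/
theorem exists_hasFDerivAt_localJacobian (H : LocalModel G Gt f p D q₀)
    {e : Module.Basis (Fin (m + 1)) ℝ (Eucl m)}
    (he : ∀ i j, inducedMetric Gt f q₀ (e i) (e j) = if i = j then 1 else 0) :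
    ∃ J' : Linf m →L[ℝ] ℝ, HasFDerivAt (localJacobian G Gt f p D) J' (f q₀) ∧
      ∀ V, (∀ v, restrictForm (Gt (f q₀)) (fderiv ℝ f q₀ v) V = 0) →
        J' V = ∑ k, localSecondForm Gt f q₀ V (e k) (e k) := by
  set T : Fin (m + 1) → Linf m := fun i => fderiv ℝ f q₀ (e i) with hTdef
  obtain ⟨c, hc, hcoer⟩ := H.coercive
  let ec : Fin (m + 1) → Eucl m →L[ℝ] ℝ := fun k => (e.coord k).toContinuousLinearMap
  have hec : ∀ k w, ec k w = e.repr w k := fun k w => rfl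
  have hD : HasFDerivAt D (fderiv ℝ D (f q₀)) (f q₀) :=
    (H.deriv_smooth.differentiableAt (by simp)).hasFDerivAt
  have hGt : DifferentiableAt ℝ Gt (f q₀) := H.metric_smooth.differentiableAt (by simp)
  have hp := H.hasFDerivAt.self_of_nhds
  have hL := H.leftInverse.self_of_nhds
  have hT : LinearIndependent ℝ T :=
    e.linearIndependent.map' (fderiv ℝ f q₀).toLinearMap
      (LinearMap.ker_eq_bot.2 (Function.LeftInverse.injective
        (g := fun u => D (f q₀) (toL2 m u)) hL))
  -- the determinant of the metric of the manifold
  let dt : Linf m → ℝ := fun φ =>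
    (Matrix.of fun i j => inducedMetric Gt f (p φ) (e i) (e j)).det
  have hdetone : (Matrix.of fun i j => inducedMetric Gt f q₀ (e i) (e j)).det = 1 := by
    rw [← Matrix.det_one (n := Fin (m + 1)) (R := ℝ)]
    congr 1
    ext i j
    simp [he, Matrix.one_apply]
  have hdt1 : dt (f q₀) = 1 := by
    simp only [dt, H.projection_apply, hdetone]
  let dq : Eucl m → ℝ := fun q => (Matrix.of fun i j => inducedMetric Gt f q (e i) (e j)).det
  have hdq : DifferentiableAt ℝ dq (p (f q₀)) := by
    rw [H.projection_apply]
    exact differentiableAt_det fun i j =>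
      H.differentiableAt_inducedMetric_apply (r := id) rfl differentiableAt_id
        (differentiableAt_const _) (differentiableAt_const _)
  have hdt : HasFDerivAt dt (fderiv ℝ dq (p (f q₀)) ∘L (D (f q₀) ∘L toL2L m)) (f q₀) :=
    HasFDerivAt.comp (g := dq) (f q₀) hdq.hasFDerivAt hp
  -- the bounds for the functionals `e_k^* ∘ d_φ p`
  let δ : Fin (m + 1) → Linf m → Ltwo m →L[ℝ] ℝ := fun k φ => ec k ∘L D φ - Gt φ (toL2 m (T k))
  have hecD : ∀ k, HasFDerivAt (fun φ => ec k ∘L D φ)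
      ((ContinuousLinearMap.postcomp (Ltwo m) (ec k)) ∘L fderiv ℝ D (f q₀)) (f q₀) := fun k =>
    HasFDerivAt.comp (g := ContinuousLinearMap.postcomp (Ltwo m) (ec k)) (f q₀)
      (ContinuousLinearMap.hasFDerivAt _) hD
  have hδ : ∀ k, DifferentiableAt ℝ (δ k) (f q₀) := fun k =>
    (hecD k).differentiableAt.sub (hGt.clm_apply (differentiableAt_const _))
  have hδ0 : ∀ k, δ k (f q₀) = 0 := by
    intro k
    -- both functionals agree on the dense subspace `L^∞` of `L²`
    refine ContinuousLinearMap.ext fun x => ?_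
    refine congrFun ((denseRange_toL2 m).equalizer (g := fun x => δ k (f q₀) x)
      (h := fun _ => (0 : ℝ)) (δ k (f q₀)).continuous continuous_const (funext fun u => ?_)) x
    have h1 := H.pairing.self_of_nhds u (e k)
    rw [← repr_eq he, H.form_symm.self_of_nhds] at h1
    simp only [Function.comp_apply, δ, sub_apply,
      ContinuousLinearMap.comp_apply, hec, h1, restrictForm_apply, hTdef, sub_self]
  let t : Fin (m + 1) → Linf m → ℝ := fun k φ =>
    2 * ec k (D φ (toL2 m (T k))) - restrictForm (Gt φ) (T k) (T k) + c⁻¹ * ‖δ k φ‖ ^ 2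
  have ht : ∀ k, ∃ t' : Linf m →L[ℝ] ℝ, HasFDerivAt (t k) t' (f q₀) ∧ ∀ V,
      t' V = 2 * e.repr (fderiv ℝ D (f q₀) V (toL2 m (T k))) k -
        fderiv ℝ (fun φ => restrictForm (Gt φ)) (f q₀) V (T k) (T k) := by
    intro k
    have h1 := ((hecD k).clm_apply (hasFDerivAt_const (toL2 m (T k)) (f q₀))).const_mul 2
    obtain ⟨d2, h2, e2⟩ := H.hasFDerivAt_metric.clm_apply₂ (hasFDerivAt_const (T k) (f q₀))
      (hasFDerivAt_const (T k) (f q₀))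
    have h3 := (hasFDerivAt_norm_sq_of_eq_zero (hδ k) (hδ0 k)).const_mul c⁻¹
    refine ⟨_, (h1.sub h2).add h3, fun V => ?_⟩
    simp [e2, hec]
  choose t' ht' ht'e using ht
  have ht0 : ∀ k, t k (f q₀) = 1 := by
    intro k
    have h1 : restrictForm (Gt (f q₀)) (T k) (T k) = 1 := by
      have := he k k
      rwa [if_pos rfl] at this
    have h2 : D (f q₀) (toL2 m (T k)) = e k := hL _
    simp only [t, hδ0, h1, h2, hec]
    norm_num
  let U : Linf m → ℝ := fun φ => √(dt φ) * Real.exp ((∑ k, t k φ - (m + 1 : ℕ)) / 2)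
  have hsum0 : ∑ k, t k (f q₀) - (m + 1 : ℕ) = 0 := by simp [ht0]
  have hU1 : U (f q₀) = 1 := by
    simp only [U, hdt1, hsum0]
    simp
  have hsum : HasFDerivAt (fun φ => ∑ k, t k φ) (∑ k, t' k) (f q₀) :=
    HasFDerivAt.fun_sum fun k _ => ht' k
  have hU := (hdt.sqrt (by rw [hdt1]; exact one_ne_zero)).mul
    ((hsum.sub_const ((m + 1 : ℕ) : ℝ)).mul_const (2 : ℝ)⁻¹).exp
  -- the lower bound
  let l : Linf m → ℝ := fun φ =>
    √((Matrix.of fun i j => inducedMetric Gt f (p φ) (D φ (toL2 m (T i))) (D φ (toL2 m (T j)))).det /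
      (Matrix.of fun i j => restrictForm (Gt φ) (T i) (T j)).det)
  have hn1 : (Matrix.of fun i j => inducedMetric Gt f (p (f q₀)) (D (f q₀) (toL2 m (T i)))
      (D (f q₀) (toL2 m (T j)))).det = 1 := by
    simp only [hTdef, hL, H.projection_apply, hdetone]
  have hn2 : (Matrix.of fun i j => restrictForm (Gt (f q₀)) (T i) (T j)).det = 1 := hdetone
  have hl1 : l (f q₀) = 1 := by
    simp only [l, hn1, hn2]
    simp
  have hld : DifferentiableAt ℝ l (f q₀) := by
    have hDT : ∀ i, DifferentiableAt ℝ (fun φ => D φ (toL2 m (T i))) (f q₀) := fun i =>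
      hD.differentiableAt.clm_apply (differentiableAt_const _)
    have d1 := differentiableAt_det (A := fun φ i j =>
      inducedMetric Gt f (p φ) (D φ (toL2 m (T i))) (D φ (toL2 m (T j)))) (x := f q₀)
      fun i j => H.differentiableAt_inducedMetric_apply H.projection_apply hp.differentiableAt
        (hDT i) (hDT j)
    have d2 := differentiableAt_det (A := fun φ i j => restrictForm (Gt φ) (T i) (T j))
      (x := f q₀) fun i j => (H.hasFDerivAt_metric.differentiableAt.clm_apply
        (differentiableAt_const _)).clm_apply (differentiableAt_const _)
    simp only [l, div_eq_mul_inv]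
    refine DifferentiableAt.sqrt (d1.fun_mul (d2.fun_inv ?_)) ?_
    · rw [hn2]; exact one_ne_zero
    · rw [hn1, hn2]; norm_num
  have hbounds : ∀ᶠ φ in 𝓝 (f q₀), l φ ≤ localJacobian G Gt f p D φ ∧
      localJacobian G Gt f p D φ ≤ U φ := by
    have hpos : ∀ᶠ φ in 𝓝 (f q₀), 0 < dt φ :=
      hdt.continuousAt.eventually (lt_mem_nhds (by rw [hdt1]; exact one_pos))
    filter_upwards [hpos, hcoer, H.metric_eq, H.scalar, H.form_symm] with φ h1 h2 h3 h4 h5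
    have := linearJacobian_mem_Icc (B := G φ) h4.symm (fun u hu => h4.pos hu)
      ((ContinuousLinearMap.coeLM ℝ).comp (inducedMetric Gt f (p φ)).toLinearMap) e h1.le
      ((D φ).toLinearMap.comp (toL2 m)) (t := fun k => t k φ) (fun k u => by
        rw [← h3]
        exact functional_bound hc h5 h2 (ec k ∘L D φ) (T k) u) hT
    simp only [← h3] at this
    refine ⟨this.1.trans_eq ?_, le_trans (le_of_eq ?_) this.2⟩ <;>
    · simp only [localJacobian, ← h3]
      rfl
  refine ⟨_, HasFDerivAt.of_squeeze hld hU (hbounds.mono fun φ h => h.1)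
    (hbounds.mono fun φ h => h.2) (hl1.trans hU1.symm), fun V hV => ?_⟩
  have hDV : D (f q₀) (toL2 m V) = 0 := by
    refine H.normal.self_of_nhds V fun v => ?_
    rw [← H.metric_eq.self_of_nhds]
    exact hV v
  have key : ∀ k, t' k V = 2 * localSecondForm Gt f q₀ V (e k) (e k) := by
    intro k
    rw [ht'e, repr_eq he, H.second_deriv_projection hV, localSecondForm]
    ring
  simp [hDV, hdt1, ht0, key, ← Finset.mul_sum]

end LocalModel

/-! ### Passing to a chart -/

section Chart

variable {m : ℕ} {M : Type*} [TopologicalSpace M] [ChartedSpace (Eucl m) M]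
  [IsManifold (𝓡 (m + 1)) ∞ M]

/-- The coordinates, in the chart at `x`, of a tangent vector at a point `y` of its domain. -/
def chartCoord (x y : M) : TangentSpace (𝓡 (m + 1)) y →L[ℝ] Eucl m :=
  haveI : IsManifold (𝓡 (m + 1)) 1 M := .of_le (n := ∞) (mod_cast le_top)
  (trivializationAt (Eucl m) (TangentSpace (𝓡 (m + 1))) x).continuousLinearMapAt ℝ y

/-- The tangent vector at `y` with the given coordinates in the chart at `x`. -/
def chartVec (x y : M) : Eucl m →L[ℝ] TangentSpace (𝓡 (m + 1)) y :=
  haveI : IsManifold (𝓡 (m + 1)) 1 M := .of_le (n := ∞) (mod_cast le_top)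
  (trivializationAt (Eucl m) (TangentSpace (𝓡 (m + 1))) x).symmL ℝ y

theorem chartVec_chartCoord {x y : M} (hy : y ∈ (chartAt (Eucl m) x).source)
    (a : TangentSpace (𝓡 (m + 1)) y) : chartVec x y (chartCoord x y a) = a :=
  haveI : IsManifold (𝓡 (m + 1)) 1 M := .of_le (n := ∞) (mod_cast le_top)
  (trivializationAt (Eucl m) (TangentSpace (𝓡 (m + 1))) x).symmL_continuousLinearMapAt
    (by simpa using hy) a

/-- The differential at `y` of a map to a normed space, as a map on the model space of `T_y M`. -/
def vectorDeriv {F : Type*} [NormedAddCommGroup F] [NormedSpace ℝ F] (Φ : M → F) (y : M) :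
    Eucl m →L[ℝ] F :=
  mfderiv (𝓡 (m + 1)) 𝓘(ℝ, F) Φ y

theorem hasFDerivAt_comp_chart_symm {F : Type*} [NormedAddCommGroup F] [NormedSpace ℝ F]
    {Φ : M → F} {x y : M} (hy : y ∈ (chartAt (Eucl m) x).source)
    (hΦ : MDifferentiableAt (𝓡 (m + 1)) 𝓘(ℝ, F) Φ y) :
    HasFDerivAt (Φ ∘ (extChartAt (𝓡 (m + 1)) x).symm)
      (vectorDeriv Φ y ∘L (chartVec x y : Eucl m →L[ℝ] Eucl m))
      (extChartAt (𝓡 (m + 1)) x y) := by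
  have : IsManifold (𝓡 (m + 1)) 1 M := .of_le (n := ∞) (mod_cast le_top)
  have hy' : y ∈ (extChartAt (𝓡 (m + 1)) x).source := by simpa using hy
  have h1 := (mdifferentiableWithinAt_extChartAt_symm (I := 𝓡 (m + 1))
    ((extChartAt (𝓡 (m + 1)) x).map_source hy')).hasMFDerivWithinAt
  have h2 : HasMFDerivAt (𝓡 (m + 1)) 𝓘(ℝ, F) Φ
      ((extChartAt (𝓡 (m + 1)) x).symm (extChartAt (𝓡 (m + 1)) x y))
      (mfderiv (𝓡 (m + 1)) 𝓘(ℝ, F) Φ y : Eucl m →L[ℝ] F) := by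
    rw [(extChartAt (𝓡 (m + 1)) x).left_inv hy']
    exact hΦ.hasMFDerivAt
  have h3 := h2.comp_hasMFDerivWithinAt _ h1
  rw [← TangentBundle.symmL_trivializationAt hy] at h3
  simp only [modelWithCornersSelf_coe, range_id, hasMFDerivWithinAt_univ] at h3
  exact h3.hasFDerivAt

theorem fderiv_comp_chart_symm {F : Type*} [NormedAddCommGroup F] [NormedSpace ℝ F]
    {Φ : M → F} {x y : M} (hy : y ∈ (chartAt (Eucl m) x).source)
    (hΦ : MDifferentiableAt (𝓡 (m + 1)) 𝓘(ℝ, F) Φ y) (a : TangentSpace (𝓡 (m + 1)) y) :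
    fderiv ℝ (Φ ∘ (extChartAt (𝓡 (m + 1)) x).symm) (extChartAt (𝓡 (m + 1)) x y)
      (chartCoord x y a) = vectorDeriv Φ y a := by
  rw [(hasFDerivAt_comp_chart_symm hy hΦ).fderiv]
  exact congrArg (vectorDeriv Φ y) (chartVec_chartCoord hy a)

theorem chartCoord_self (x : M) (a : TangentSpace (𝓡 (m + 1)) x) : chartCoord x x a = a := by
  have : IsManifold (𝓡 (m + 1)) 1 M := .of_le (n := ∞) (mod_cast le_top)
  unfold chartCoord
  rw [TangentBundle.continuousLinearMapAt_trivializationAt (mem_chart_source _ x),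
    mfderiv_extChartAt_self]
  rfl

theorem contDiffAt_comp_chart_symm {F : Type*} [NormedAddCommGroup F] [NormedSpace ℝ F]
    {n : WithTop ℕ∞} (hn : n ≤ ∞)
    {Φ : M → F} {x y : M} (hy : y ∈ (chartAt (Eucl m) x).source)
    (hΦ : ContMDiffAt (𝓡 (m + 1)) 𝓘(ℝ, F) n Φ y) :
    ContDiffAt ℝ n (Φ ∘ (extChartAt (𝓡 (m + 1)) x).symm) (extChartAt (𝓡 (m + 1)) x y) := by
  have hy' : y ∈ (extChartAt (𝓡 (m + 1)) x).source := by simpa using hy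
  have h1 : ContMDiffAt 𝓘(ℝ, Eucl m) (𝓡 (m + 1)) n (extChartAt (𝓡 (m + 1)) x).symm
      (extChartAt (𝓡 (m + 1)) x y) :=
    ((contMDiffOn_extChartAt_symm (I := 𝓡 (m + 1)) (n := ∞) x).contMDiffAt
      (extChartAt_target_mem_nhds' ((extChartAt (𝓡 (m + 1)) x).map_source hy'))).of_le hn
  rw [← contMDiffAt_iff_contDiffAt]
  refine ContMDiffAt.comp _ ?_ h1
  rwa [(extChartAt (𝓡 (m + 1)) x).left_inv hy']

theorem hasFDerivAt_chart_comp {E : Type*} [NormedAddCommGroup E] [NormedSpace ℝ E]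
    {P : E → M} {x : M} {φ : E} (hy : P φ ∈ (chartAt (Eucl m) x).source)
    (hP : MDifferentiableAt 𝓘(ℝ, E) (𝓡 (m + 1)) P φ) :
    HasFDerivAt (extChartAt (𝓡 (m + 1)) x ∘ P)
      ((chartCoord x (P φ) : Eucl m →L[ℝ] Eucl m) ∘L
        (mfderiv 𝓘(ℝ, E) (𝓡 (m + 1)) P φ : E →L[ℝ] Eucl m)) φ := by
  have : IsManifold (𝓡 (m + 1)) 1 M := .of_le (n := ∞) (mod_cast le_top)
  have h1 := (mdifferentiableAt_extChartAt (I := 𝓡 (m + 1)) hy).hasMFDerivAt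
  have h3 := h1.comp φ hP.hasMFDerivAt
  rw [← TangentBundle.continuousLinearMapAt_trivializationAt hy] at h3
  exact h3.hasFDerivAt

variable {g : Bundle.ContMDiffRiemannianMetric (𝓡 (m + 1)) ∞ (Eucl m)
      (fun x : M => TangentSpace (𝓡 (m + 1)) x)}
  {U : Set (Linf m)} {G : Linf m → LForm m} {Φ : M → Linf m} {P : Linf m → M}

theorem IsSmoothIsometricImmersion.mdifferentiableAt
    (hΦ : IsSmoothIsometricImmersion g U G Φ) (y : M) :
    MDifferentiableAt (𝓡 (m + 1)) 𝓘(ℝ, Linf m) Φ y :=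
  (hΦ.smooth y).mdifferentiableAt (by simp)

/-- Read in a chart, an isometric immersion and a projection form a local model. -/
theorem exists_localModel (hU : IsOpen U) (hG : IsRiemannianMetric U G)
    (hΦ : IsSmoothIsometricImmersion g U G Φ) (hP : IsProjection U G Φ P) (x : M) :
    ∃ (Gt : Linf m → Ltwo m →L[ℝ] Ltwo m →L[ℝ] ℝ) (D : Linf m → Ltwo m →L[ℝ] Eucl m),
      LocalModel G Gt (Φ ∘ (extChartAt (𝓡 (m + 1)) x).symm) (extChartAt (𝓡 (m + 1)) x ∘ P) D
        (extChartAt (𝓡 (m + 1)) x x) ∧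
      mapJacobian g G P =ᶠ[𝓝 (Φ x)] LocalModel.localJacobian G Gt
        (Φ ∘ (extChartAt (𝓡 (m + 1)) x).symm) (extChartAt (𝓡 (m + 1)) x ∘ P) D := by
  have : IsManifold (𝓡 (m + 1)) 1 M := .of_le (n := ∞) (mod_cast le_top)
  obtain ⟨Gt, hGt, hGts⟩ := hG.smooth
  obtain ⟨hPd, D, hD, hDs⟩ := hP.l2smooth
  set ch := extChartAt (𝓡 (m + 1)) x with hch
  have hx : x ∈ (chartAt (Eucl m) x).source := mem_chart_source _ x
  have hfx : (Φ ∘ ch.symm) (ch x) = Φ x := by simp [hch]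
  have hUx : ∀ᶠ φ in 𝓝 (Φ x), φ ∈ U := hU.mem_nhds (hΦ.mem x)
  have hPx : ∀ᶠ φ in 𝓝 (Φ x), P φ ∈ (chartAt (Eucl m) x).source := by
    have h1 : ContinuousAt P (Φ x) := (hPd _ (hΦ.mem x)).continuousAt
    refine h1.eventually ?_
    rw [hP.retraction]
    exact (chartAt (Eucl m) x).open_source.mem_nhds hx
  have hq : ∀ᶠ q in 𝓝 (ch x), q ∈ ch.target := extChartAt_target_mem_nhds x
  have hsrc : ∀ q ∈ ch.target, ch.symm q ∈ (chartAt (Eucl m) x).source := fun q hq => by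
    have := ch.map_target hq
    rwa [hch, extChartAt_source] at this
  have hright : ∀ q ∈ ch.target, ch (ch.symm q) = q := fun q hq => ch.right_inv hq
  let D' : Linf m → Ltwo m →L[ℝ] Eucl m := fun φ =>
    (chartCoord x (P φ) : Eucl m →L[ℝ] Eucl m) ∘L (D φ : Ltwo m →L[ℝ] Eucl m)
  refine ⟨Gt, D', ⟨?_, ?_, ?_, ?_, ?_, ?_, ?_, ?_⟩, ?_⟩
  · rw [hfx]
    exact hGts.contDiffAt hUx
  · rw [hfx]
    filter_upwards [hUx] with φ h using hGt φ h
  · rw [hfx]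
    filter_upwards [hUx] with φ h using hG.scalar φ h
  · exact contDiffAt_comp_chart_symm le_rfl hx (hΦ.smooth x)
  · rw [hfx]
    have key : ∀ z, P (Φ x) = z → ContDiffAt ℝ ∞ (fun φ =>
        (chartCoord z (P φ) : Eucl m →L[ℝ] Eucl m) ∘L (D φ : Ltwo m →L[ℝ] Eucl m)) (Φ x) := by
      rintro z rfl
      exact hDs (Φ x) (hΦ.mem x)
    exact key x (hP.retraction x)
  · rw [hfx]
    filter_upwards [hUx, hPx] with φ h1 h2
    refine (hasFDerivAt_chart_comp h2 (hPd φ h1)).congr_fderiv ?_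
    ext1 u
    exact congrArg (chartCoord x (P φ)) (hD φ h1 u).symm
  · filter_upwards [hq] with q h
    simp [hP.retraction, hright q h]
  · filter_upwards [hq] with q h V hV
    have h1 : IsNormal G Φ (ch.symm q) V := by
      rintro _ ⟨a, rfl⟩
      have h2 := hV (chartCoord x (ch.symm q) a)
      have h3 := fderiv_comp_chart_symm (hsrc q h) (hΦ.mdifferentiableAt _) a
      rw [← hch, hright q h] at h3
      rw [h3] at h2
      exact h2
    have h2 := hP.normal _ V h1
    have h3 := hD (Φ (ch.symm q)) (hΦ.mem _) V
    rw [h2] at h3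
    exact (congrArg (chartCoord x (P (Φ (ch.symm q)))) h3).trans (map_zero _)
  · filter_upwards [hUx, hPx] with φ h1 h2
    have key : ∀ a : TangentSpace (𝓡 (m + 1)) (P φ),
        fderiv ℝ (Φ ∘ ch.symm) (ch (P φ)) (chartCoord x (P φ) a) = surfDeriv Φ (P φ) a :=
      fderiv_comp_chart_symm h2 (hΦ.mdifferentiableAt _)
    refine linearJacobian_congr fun u v => ?_
    have h3 : (Φ ∘ ch.symm) (ch (P φ)) = Φ (P φ) := by
      have : P φ ∈ ch.source := by rwa [hch, extChartAt_source]
      simp [ch.left_inv this]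
    have e1 : D' φ (toL2 m u) = chartCoord x (P φ) (mfderiv 𝓘(ℝ, Linf m) (𝓡 (m + 1)) P φ u) :=
      congrArg (chartCoord x (P φ)) (hD φ h1 u)
    have e2 : D' φ (toL2 m v) = chartCoord x (P φ) (mfderiv 𝓘(ℝ, Linf m) (𝓡 (m + 1)) P φ v) :=
      congrArg (chartCoord x (P φ)) (hD φ h1 v)
    have e3 : ∀ a b : TangentSpace (𝓡 (m + 1)) (P φ),
        inducedMetric Gt (Φ ∘ ch.symm) (ch (P φ)) (chartCoord x (P φ) a) (chartCoord x (P φ) b) =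
          g.inner (P φ) a b := by
      intro a b
      rw [inducedMetric_apply, key, key, h3, restrictForm_apply, hGt _ (hΦ.mem _), hΦ.isometric]
    exact (e3 _ _).symm.trans (congrArg₂ (fun a b : Eucl m =>
      inducedMetric Gt (Φ ∘ ch.symm) (ch (P φ)) a b) e1.symm e2.symm)

end Chart

/-! ### The second fundamental form -/

/-- The Christoffel symbol of a metric pulled back from `𝓛` by a parametrization `ψ`. -/
theorem christoffel_pullback {X E : Type*} [NormedAddCommGroup X] [NormedSpace ℝ X]
    [NormedAddCommGroup E] [NormedSpace ℝ E] {K : E → E →L[ℝ] E →L[ℝ] ℝ} {ψ : X → E} {p : X}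
    {h : X → X → X → ℝ} (hψ : ContDiffAt ℝ ∞ ψ p) (hK : DifferentiableAt ℝ K (ψ p))
    (hs : ∀ a b, K (ψ p) a b = K (ψ p) b a)
    (hh : ∀ᶠ q in 𝓝 p, ∀ a b, h q a b = K (ψ q) (fderiv ℝ ψ q a) (fderiv ℝ ψ q b)) (a v : X) :
    christoffel h p a a v =
      fderiv ℝ K (ψ p) (fderiv ℝ ψ p a) (fderiv ℝ ψ p a) (fderiv ℝ ψ p v)
      + K (ψ p) (fderiv ℝ (fderiv ℝ ψ) p a a) (fderiv ℝ ψ p v)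
      - (1 / 2) * fderiv ℝ K (ψ p) (fderiv ℝ ψ p v) (fderiv ℝ ψ p a) (fderiv ℝ ψ p a) := by
  have h1 : HasFDerivAt ψ (fderiv ℝ ψ p) p := (hψ.differentiableAt (by simp)).hasFDerivAt
  have h2 : HasFDerivAt (fderiv ℝ ψ) (fderiv ℝ (fderiv ℝ ψ) p) p :=
    ((hψ.fderiv_right (m := 1) two_le_smooth).differentiableAt (by simp)).hasFDerivAt
  have h3 : HasFDerivAt (fun q => K (ψ q)) (fderiv ℝ K (ψ p) ∘L fderiv ℝ ψ p) p :=
    HasFDerivAt.comp (g := K) p hK.hasFDerivAt h1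
  have key : ∀ x y z, fderiv ℝ (fun q => h q y z) p x =
      fderiv ℝ K (ψ p) (fderiv ℝ ψ p x) (fderiv ℝ ψ p y) (fderiv ℝ ψ p z)
      + K (ψ p) (fderiv ℝ (fderiv ℝ ψ) p x y) (fderiv ℝ ψ p z)
      + K (ψ p) (fderiv ℝ ψ p y) (fderiv ℝ (fderiv ℝ ψ) p x z) := by
    intro x y z
    obtain ⟨d, hd, e⟩ := h3.clm_apply₂ (h2.clm_apply (hasFDerivAt_const y p))
      (h2.clm_apply (hasFDerivAt_const z p))
    have : (fun q => h q y z) =ᶠ[𝓝 p]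
        fun q => K (ψ q) (fderiv ℝ ψ q y) (fderiv ℝ ψ q z) := hh.mono fun q hq => hq y z
    rw [(hd.congr_of_eventuallyEq this).fderiv, e]
    simp
  have hsymm : fderiv ℝ (fderiv ℝ ψ) p v a = fderiv ℝ (fderiv ℝ ψ) p a v :=
    (hψ.isSymmSndFDerivAt (by simpa using two_le_smooth)).eq v a
  simp only [christoffel, key, hsymm]
  rw [hs _ (fderiv ℝ ψ p a)]
  ring

theorem fderiv_fderiv_comp {X Y E : Type*} [NormedAddCommGroup X] [NormedSpace ℝ X]
    [NormedAddCommGroup Y] [NormedSpace ℝ Y] [NormedAddCommGroup E] [NormedSpace ℝ E]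
    {ψ : Y → E} {s : X → Y} {g : X → E} {q : X} (hψ : ContDiffAt ℝ ∞ ψ (s q))
    (hs : ContDiffAt ℝ ∞ s q) (h : ∀ᶠ x in 𝓝 q, ψ (s x) = g x) :
    fderiv ℝ g q = fderiv ℝ ψ (s q) ∘L fderiv ℝ s q ∧
    ∀ v w, fderiv ℝ (fderiv ℝ g) q v w =
      fderiv ℝ (fderiv ℝ ψ) (s q) (fderiv ℝ s q v) (fderiv ℝ s q w)
      + fderiv ℝ ψ (s q) (fderiv ℝ (fderiv ℝ s) q v w) := by
  have hψ1 : ∀ᶠ y in 𝓝 (s q), DifferentiableAt ℝ ψ y :=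
    ((hψ.of_le (m := 1) (by exact_mod_cast le_top)).eventually (by simp)).mono fun y hy =>
      hy.differentiableAt (by simp)
  have hs1 : ∀ᶠ x in 𝓝 q, DifferentiableAt ℝ s x :=
    ((hs.of_le (m := 1) (by exact_mod_cast le_top)).eventually (by simp)).mono fun y hy =>
      hy.differentiableAt (by simp)
  have hfd : ∀ᶠ x in 𝓝 q, fderiv ℝ g x = fderiv ℝ ψ (s x) ∘L fderiv ℝ s x := by
    filter_upwards [h.eventually_nhds, hs.continuousAt.eventually hψ1, hs1] with x h1 h2 h3
    have h4 : (fun y => ψ (s y)) =ᶠ[𝓝 x] g := h1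
    rw [← h4.fderiv_eq]
    exact fderiv_comp x h2 h3
  refine ⟨hfd.self_of_nhds, fun v w => ?_⟩
  have d1 : HasFDerivAt (fderiv ℝ ψ) (fderiv ℝ (fderiv ℝ ψ) (s q)) (s q) :=
    ((hψ.fderiv_right (m := 1) two_le_smooth).differentiableAt (by simp)).hasFDerivAt
  have d2 : HasFDerivAt (fderiv ℝ s) (fderiv ℝ (fderiv ℝ s) q) q :=
    ((hs.fderiv_right (m := 1) two_le_smooth).differentiableAt (by simp)).hasFDerivAt
  have d3 := (HasFDerivAt.comp q d1 hs1.self_of_nhds.hasFDerivAt).clm_comp d2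
  rw [(d3.congr_of_eventuallyEq hfd).fderiv]
  simp [add_comm]

section Chart

variable {m : ℕ} {M : Type*} [TopologicalSpace M] [ChartedSpace (Eucl m) M]
  [IsManifold (𝓡 (m + 1)) ∞ M]
  {g : Bundle.ContMDiffRiemannianMetric (𝓡 (m + 1)) ∞ (Eucl m)
      (fun x : M => TangentSpace (𝓡 (m + 1)) x)}
  {U : Set (Linf m)} {G : Linf m → LForm m} {Φ : M → Linf m}

/-- A vector field that is smooth at `x` is differentiable in the chart at `x`. -/
theorem differentiableAt_chartCoord {x : M} {τ : (y : M) → TangentSpace (𝓡 (m + 1)) y}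
    (hτ : ContMDiffAt (𝓡 (m + 1)) (𝓡 (m + 1)).tangent ∞
      (fun y => (⟨y, τ y⟩ : TangentBundle (𝓡 (m + 1)) M)) x) :
    DifferentiableAt ℝ ((fun y => (chartCoord x y (τ y) : Eucl m)) ∘
      (extChartAt (𝓡 (m + 1)) x).symm) (extChartAt (𝓡 (m + 1)) x x) := by
  have : IsManifold (𝓡 (m + 1)) 1 M := .of_le (n := ∞) (mod_cast le_top)
  have h1 := (Bundle.contMDiffAt_section (n := ∞) (IB := 𝓡 (m + 1)) (F := Eucl m)
    (s := τ) x).1 hτ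
  have h2 : ContMDiffAt (𝓡 (m + 1)) 𝓘(ℝ, Eucl m) ∞
      (fun y => (chartCoord x y (τ y) : Eucl m)) x := by
    refine h1.congr_of_eventuallyEq ?_
    filter_upwards [(chartAt (Eucl m) x).open_source.mem_nhds (mem_chart_source _ x)] with y hy
    unfold chartCoord
    rw [Bundle.Trivialization.continuousLinearMapAt_apply,
      Bundle.Trivialization.coe_linearMapAt_of_mem _ (by simpa using hy)]
  exact (contDiffAt_comp_chart_symm le_rfl (mem_chart_source _ x) h2).differentiableAt (by simp)

/-- The pairing `G(∇_T T̃, V)` does not depend on the auxiliary submanifold, nor on the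
extension of `T`: in a chart it is the local second fundamental form. -/
theorem covDerivPairing_eq {Gt : Linf m → Ltwo m →L[ℝ] Ltwo m →L[ℝ] ℝ}
    {p : Linf m → Eucl m} {D : Linf m → Ltwo m →L[ℝ] Eucl m} {x : M} {V : Linf m}
    (H : LocalModel G Gt (Φ ∘ (extChartAt (𝓡 (m + 1)) x).symm) p D (extChartAt (𝓡 (m + 1)) x x))
    (hV : ∀ v, restrictForm (Gt (Φ x))
      (fderiv ℝ (Φ ∘ (extChartAt (𝓡 (m + 1)) x).symm) (extChartAt (𝓡 (m + 1)) x x) v) V = 0)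
    (F : AuxSubmanifold U Φ x V) {τ : (y : M) → TangentSpace (𝓡 (m + 1)) y}
    (hτ : ContMDiffAt (𝓡 (m + 1)) (𝓡 (m + 1)).tangent ∞
      (fun y => (⟨y, τ y⟩ : TangentBundle (𝓡 (m + 1)) M)) x) :
    F.covDerivPairing G τ = localSecondForm Gt (Φ ∘ (extChartAt (𝓡 (m + 1)) x).symm)
      (extChartAt (𝓡 (m + 1)) x x) V (τ x) (τ x) := by
  have hx : x ∈ (chartAt (Eucl m) x).source := mem_chart_source _ x
  set ch := extChartAt (𝓡 (m + 1)) x with hch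
  set f : Eucl m → Linf m := Φ ∘ ch.symm with hf
  set q₀ : Eucl m := ch x with hq₀
  have hsymm : ch.symm q₀ = x := by simp [hq₀, hch]
  have hfx : f q₀ = Φ x := by simp [hf, hsymm]
  set s : Eucl m → EuclideanSpace ℝ (Fin F.k) := F.σ ∘ ch.symm with hs
  have hsq : s q₀ = F.σ x := by simp [hs, hsymm]
  have hsc : ContDiffAt ℝ ∞ s q₀ := contDiffAt_comp_chart_symm le_rfl hx F.σ_smooth
  have htend : Tendsto ch.symm (𝓝 q₀) (𝓝 x) := by
    have h := continuousAt_extChartAt_symm (I := 𝓡 (m + 1)) x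
    rwa [ContinuousAt, ← hch, hsymm] at h
  have hψc : ContDiffAt ℝ ∞ F.ψ (s q₀) := by
    rw [hsq]
    exact F.smooth.contDiffAt (F.isOpen.mem_nhds F.σ_mem.self_of_nhds)
  have hψs : ∀ᶠ q in 𝓝 q₀, F.ψ (s q) = f q := htend.eventually F.σ_lift
  have hψ0 : F.ψ (s q₀) = f q₀ := hψs.self_of_nhds
  obtain ⟨hf1, hf2⟩ := fderiv_fderiv_comp hψc hsc hψs
  -- the vector field in coordinates
  set t : Eucl m → Eucl m := (fun y => (chartCoord x y (τ y) : Eucl m)) ∘ ch.symm with ht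
  have htd : DifferentiableAt ℝ t q₀ := differentiableAt_chartCoord hτ
  suffices key : ∀ a : Eucl m, τ x = a →
      F.covDerivPairing G τ = localSecondForm Gt f q₀ V a a from key (τ x) rfl
  intro a ha
  have ht0 : t q₀ = a := by
    have : t q₀ = chartCoord x (ch.symm q₀) (τ (ch.symm q₀)) := rfl
    rw [this, hsymm, chartCoord_self, ha]
  have hσd : ∀ᶠ y in 𝓝 x, MDifferentiableAt (𝓡 (m + 1)) 𝓘(ℝ, EuclideanSpace ℝ (Fin F.k)) F.σ y := by
    have : IsManifold (𝓡 (m + 1)) 1 M := .of_le (n := ∞) (mod_cast le_top)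
    have h1 : ContMDiffAt (𝓡 (m + 1)) 𝓘(ℝ, EuclideanSpace ℝ (Fin F.k)) 1 F.σ x :=
      F.σ_smooth.of_le (by exact_mod_cast le_top)
    exact ((contMDiffAt_iff_contMDiffAt_nhds (by simp)).1 h1).mono fun y hy =>
      hy.mdifferentiableAt (by simp)
  have hsrc : ∀ᶠ y in 𝓝 x, y ∈ (chartAt (Eucl m) x).source :=
    (chartAt (Eucl m) x).open_source.mem_nhds hx
  have hfield : ∀ᶠ y in 𝓝 x, F.field τ y = fderiv ℝ s (ch y) (t (ch y)) := by
    filter_upwards [hσd, hsrc] with y h1 h2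
    have h3 := fderiv_comp_chart_symm h2 h1 (τ y)
    have h4 : t (ch y) = chartCoord x (ch.symm (ch y)) (τ (ch.symm (ch y))) := rfl
    have h5 : ch.symm (ch y) = y := ch.left_inv (by rwa [hch, extChartAt_source])
    rw [h4, h5]
    exact h3.symm
  have hs2 : HasFDerivAt (fderiv ℝ s) (fderiv ℝ (fderiv ℝ s) q₀) q₀ :=
    ((hsc.fderiv_right (m := 1) two_le_smooth).differentiableAt (by simp)).hasFDerivAt
  have hfd := hs2.clm_apply htd.hasFDerivAt
  have hfieldmd : MDifferentiableAt (𝓡 (m + 1)) 𝓘(ℝ, EuclideanSpace ℝ (Fin F.k)) (F.field τ) x := by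
    have : IsManifold (𝓡 (m + 1)) 1 M := .of_le (n := ∞) (mod_cast le_top)
    have h1 : MDifferentiableAt (𝓡 (m + 1)) 𝓘(ℝ, EuclideanSpace ℝ (Fin F.k))
        ((fun q => fderiv ℝ s q (t q)) ∘ ch) x :=
      MDifferentiableAt.comp x hfd.differentiableAt.mdifferentiableAt
        (mdifferentiableAt_extChartAt (I := 𝓡 (m + 1)) hx)
    exact h1.congr_of_eventuallyEq hfield
  have hcov : vectorDeriv (F.field τ) x a =
      fderiv ℝ (fderiv ℝ s) q₀ a a + fderiv ℝ s q₀ (fderiv ℝ t q₀ a) := by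
    have h1 : fderiv ℝ (F.field τ ∘ ch.symm) q₀ a = vectorDeriv (F.field τ) x a := by
      have := fderiv_comp_chart_symm hx hfieldmd (τ x)
      rwa [chartCoord_self, ha] at this
    have h2 : F.field τ ∘ ch.symm =ᶠ[𝓝 q₀] fun q => fderiv ℝ s q (t q) := by
      filter_upwards [htend.eventually hfield, extChartAt_target_mem_nhds (I := 𝓡 (m + 1)) x]
        with q h3 h4
      rw [Function.comp_apply, h3, ch.right_inv h4]
    rw [← h1]
    have h3 := (hfd.congr_of_eventuallyEq h2).fderiv
    refine (congrArg (fun A : Eucl m →L[ℝ] EuclideanSpace ℝ (Fin F.k) => A a) h3).trans ?_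
    rw [add_apply, ContinuousLinearMap.comp_apply, ContinuousLinearMap.flip_apply, ht0, add_comm]
  have hfield0 : F.field τ x = fderiv ℝ s q₀ a := by
    have := hfield.self_of_nhds
    rwa [← hq₀, ht0] at this
  have hmetric : ∀ᶠ q in 𝓝 (s q₀), ∀ a b, F.metric G q a b =
      restrictForm (Gt (F.ψ q)) (fderiv ℝ F.ψ q a) (fderiv ℝ F.ψ q b) := by
    have h1 := H.metric_eq
    rw [← hψ0] at h1
    filter_upwards [hψc.continuousAt.eventually h1] with q hq a b
    exact (hq _ _).symm
  have hKs : ∀ a b, restrictForm (Gt (F.ψ (s q₀))) a b = restrictForm (Gt (F.ψ (s q₀))) b a := by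
    rw [hψ0]
    exact H.form_symm.self_of_nhds
  have hKd : DifferentiableAt ℝ (fun φ => restrictForm (Gt φ)) (F.ψ (s q₀)) := by
    rw [hψ0]
    exact H.hasFDerivAt_metric.differentiableAt
  have hchr := christoffel_pullback (K := fun φ => restrictForm (Gt φ)) hψc hKd hKs hmetric
    (fderiv ℝ s q₀ a) F.Vc
  have hT : fderiv ℝ F.ψ (s q₀) F.Vc = V := by rw [hsq]; exact F.tangent
  have hd : ∀ v, fderiv ℝ F.ψ (s q₀) (fderiv ℝ s q₀ v) = fderiv ℝ f q₀ v := fun v => by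
    rw [hf1]; rfl
  have e1 : F.covDerivPairing G τ = F.metric G (s q₀) (vectorDeriv (F.field τ) x a) F.Vc
      + christoffel (F.metric G) (s q₀) (F.field τ x) (F.field τ x) F.Vc := by
    rw [hsq, ← ha]; rfl
  rw [← hfx] at hV
  rw [e1, hcov, hfield0, hchr, hmetric.self_of_nhds, map_add, hT, hd, hd, hψ0, localSecondForm, hf2,
    map_add, map_add, add_apply, add_apply, hV]
  ring

end Chart

/-! ### Existence of auxiliary submanifolds -/

/-- An immersion of a finite-dimensional space is an embedding of a neighbourhood of each point. -/
theorem exists_isEmbedding_restrict {X E : Type*} [NormedAddCommGroup X] [NormedSpace ℝ X]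
    [FiniteDimensional ℝ X] [NormedAddCommGroup E] [NormedSpace ℝ E] [CompleteSpace E] {ψ : X → E} {p : X}
    {O : Set X} (hO : O ∈ 𝓝 p) (hψ : ∀ q ∈ O, ContDiffAt ℝ ∞ ψ q)
    (hinj : Function.Injective (fderiv ℝ ψ p)) :
    ∃ W : Set X, IsOpen W ∧ p ∈ W ∧ W ⊆ O ∧ (∀ q ∈ W, Function.Injective (fderiv ℝ ψ q)) ∧
      IsEmbedding (W.domRestrict ψ) := by
  have : CompleteSpace X := FiniteDimensional.complete ℝ X
  obtain ⟨ℓ, hℓ⟩ :=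
    ContinuousLinearMap.HasLeftInverse.of_injective_of_isClosed_range_of_closedComplement_range
      hinj (Submodule.closed_of_finiteDimensional (fderiv ℝ ψ p).range)
      (Submodule.ClosedComplemented.of_finiteDimensional _)
  have hp : ContDiffAt ℝ ∞ ψ p := hψ p (mem_of_mem_nhds hO)
  have hid : ℓ ∘L fderiv ℝ ψ p = ContinuousLinearMap.id ℝ X := by
    ext v
    exact hℓ v
  have hk : HasStrictFDerivAt (ℓ ∘ ψ) ((ContinuousLinearEquiv.refl ℝ X : X ≃L[ℝ] X) : X →L[ℝ] X)
      p := by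
    have := ℓ.hasStrictFDerivAt.comp p (hp.hasStrictFDerivAt (by simp))
    rwa [hid] at this
  have hcont : ContinuousAt (fun q => ℓ ∘L fderiv ℝ ψ q) p :=
    continuousAt_const.clm_comp
      (hp.fderiv_right (m := 1) two_le_smooth).continuousAt
  have hunit : ∀ᶠ q in 𝓝 p, IsUnit (ℓ ∘L fderiv ℝ ψ q) := by
    refine hcont.eventually (Units.isOpen.mem_nhds ?_)
    show IsUnit (ℓ ∘L fderiv ℝ ψ p)
    rw [hid]
    exact isUnit_one
  have hev : ∀ᶠ q in 𝓝 p, q ∈ hk.toOpenPartialHomeomorph.source ∧ q ∈ O ∧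
      IsUnit (ℓ ∘L fderiv ℝ ψ q) := by
    filter_upwards [hk.toOpenPartialHomeomorph.open_source.mem_nhds
      hk.mem_toOpenPartialHomeomorph_source, hO, hunit] with q h1 h2 h3 using ⟨h1, h2, h3⟩
  obtain ⟨W, hW, hWo, hpW⟩ := mem_nhds_iff.1 hev
  refine ⟨W, hWo, hpW, fun q hq => (hW hq).2.1, fun q hq => ?_, ?_⟩
  · obtain ⟨u, hu⟩ := (hW hq).2.2
    refine Function.Injective.of_comp (f := ℓ) ?_
    intro a b hab
    have h1 : (u : X →L[ℝ] X) a = (u : X →L[ℝ] X) b := by rw [hu]; exact hab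
    have h2 := congrArg (fun c => ((u⁻¹ : (X →L[ℝ] X)ˣ) : X →L[ℝ] X) c) h1
    have h3 : ∀ c, ((u⁻¹ : (X →L[ℝ] X)ˣ) : X →L[ℝ] X) ((u : X →L[ℝ] X) c) = c := fun c =>
      congrArg (fun A : X →L[ℝ] X => A c) u.inv_mul
    simpa only [h3] using h2
  · have hc : Continuous (W.domRestrict ψ) := continuousOn_iff_continuous_domRestrict.1 fun q hq =>
      (hψ q (hW hq).2.1).continuousAt.continuousWithinAt
    refine IsEmbedding.of_comp hc ℓ.continuous ?_
    exact hk.toOpenPartialHomeomorph.isOpenEmbedding_restrict.isEmbedding.comp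
      (IsEmbedding.inclusion fun q hq => (hW hq).1)

section Chart

variable {m : ℕ} {M : Type*} [TopologicalSpace M] [ChartedSpace (Eucl m) M]
  [IsManifold (𝓡 (m + 1)) ∞ M]
  {g : Bundle.ContMDiffRiemannianMetric (𝓡 (m + 1)) ∞ (Eucl m)
      (fun x : M => TangentSpace (𝓡 (m + 1)) x)}
  {U : Set (Linf m)} {G : Linf m → LForm m} {Φ : M → Linf m}

/-- The submanifold swept out by the translates of a piece of `Φ` in the direction `V`. -/
theorem nonempty_auxSubmanifold (hU : IsOpen U) (hΦ : IsSmoothIsometricImmersion g U G Φ)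
    {Gt : Linf m → Ltwo m →L[ℝ] Ltwo m →L[ℝ] ℝ}
    {p : Linf m → Eucl m} {D : Linf m → Ltwo m →L[ℝ] Eucl m} {x : M} {V : Linf m}
    (H : LocalModel G Gt (Φ ∘ (extChartAt (𝓡 (m + 1)) x).symm) p D (extChartAt (𝓡 (m + 1)) x x))
    (hV : ∀ v, restrictForm (Gt (Φ x))
      (fderiv ℝ (Φ ∘ (extChartAt (𝓡 (m + 1)) x).symm) (extChartAt (𝓡 (m + 1)) x x) v) V = 0) :
    Nonempty (AuxSubmanifold U Φ x V) := by
  have hx : x ∈ (chartAt (Eucl m) x).source := mem_chart_source _ x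
  set ch := extChartAt (𝓡 (m + 1)) x with hch
  set f : Eucl m → Linf m := Φ ∘ ch.symm with hf
  set q₀ : Eucl m := ch x with hq₀
  have hsymm : ch.symm q₀ = x := by simp [hq₀, hch]
  have hfx : f q₀ = Φ x := by simp [hf, hsymm]
  have hsrc : ∀ q ∈ ch.target, ch.symm q ∈ (chartAt (Eucl m) x).source := fun q hq => by
    have := ch.map_target hq
    rwa [hch, extChartAt_source] at this
  have hfs : ∀ q ∈ ch.target, ContDiffAt ℝ ∞ f q := fun q hq => by
    have := contDiffAt_comp_chart_symm le_rfl (hsrc q hq) (hΦ.smooth (ch.symm q))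
    rwa [← hch, ch.right_inv hq] at this
  let N := Submodule.span ℝ {V}
  let X := Eucl m × N
  let L : EuclideanSpace ℝ (Fin (Module.finrank ℝ X)) ≃L[ℝ] X :=
    ContinuousLinearEquiv.ofFinrankEq (by simp)
  let ψ : EuclideanSpace ℝ (Fin (Module.finrank ℝ X)) → Linf m := fun z =>
    f (L z).1 + ((L z).2 : Linf m)
  let σ : M → EuclideanSpace ℝ (Fin (Module.finrank ℝ X)) := fun y => L.symm (ch y, 0)
  let O : Set (EuclideanSpace ℝ (Fin (Module.finrank ℝ X))) :=
    {z | (L z).1 ∈ ch.target ∧ ψ z ∈ U}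
  let z₀ := L.symm (q₀, 0)
  have hLz₀ : L z₀ = (q₀, 0) := L.apply_symm_apply _
  have hψs : ∀ z, (L z).1 ∈ ch.target → ContDiffAt ℝ ∞ ψ z := fun z hz => by
    refine ContDiffAt.add ?_ ?_
    · exact ContDiffAt.comp (g := f) z (hfs _ hz) (contDiffAt_fst.comp z L.contDiff.contDiffAt)
    · exact (N.subtypeL.contDiff.contDiffAt).comp z
        (contDiffAt_snd.comp z L.contDiff.contDiffAt)
  have hz₀t : (L z₀).1 ∈ ch.target := by
    rw [hLz₀]
    exact mem_extChartAt_target (I := 𝓡 (m + 1)) x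
  have hψ0 : ψ z₀ = Φ x := by simp [ψ, hLz₀, hfx]
  have hO : O ∈ 𝓝 z₀ := by
    have h1 : ∀ᶠ z in 𝓝 z₀, (L z).1 ∈ ch.target := by
      have : ContinuousAt (fun z => (L z).1) z₀ := (continuous_fst.comp L.continuous).continuousAt
      refine this.eventually ?_
      show ∀ᶠ y in 𝓝 (L z₀).1, y ∈ ch.target
      rw [hLz₀]
      exact extChartAt_target_mem_nhds (I := 𝓡 (m + 1)) x
    have h2 : ∀ᶠ z in 𝓝 z₀, ψ z ∈ U := by
      refine (hψs z₀ hz₀t).continuousAt.eventually (hU.mem_nhds ?_)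
      rw [hψ0]
      exact hΦ.mem x
    exact h1.and h2
  have hderiv : HasFDerivAt ψ (fderiv ℝ f q₀ ∘L (ContinuousLinearMap.fst ℝ (Eucl m) N ∘L L)
      + N.subtypeL ∘L (ContinuousLinearMap.snd ℝ (Eucl m) N ∘L L)) z₀ := by
    refine HasFDerivAt.add ?_ (ContinuousLinearMap.hasFDerivAt
      (N.subtypeL ∘L (ContinuousLinearMap.snd ℝ (Eucl m) N ∘L (L : EuclideanSpace ℝ (Fin (Module.finrank ℝ X)) →L[ℝ] X))))
    have h1 : HasFDerivAt f (fderiv ℝ f q₀) (L z₀).1 := by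
      rw [hLz₀]
      exact H.eventually_differentiableAt.self_of_nhds.hasFDerivAt
    exact HasFDerivAt.comp (g := f) z₀ h1 (ContinuousLinearMap.hasFDerivAt
      (ContinuousLinearMap.fst ℝ (Eucl m) N ∘L (L : EuclideanSpace ℝ (Fin (Module.finrank ℝ X)) →L[ℝ] X)))
  have hdapply : ∀ z, fderiv ℝ ψ z₀ z = fderiv ℝ f q₀ (L z).1 + ((L z).2 : Linf m) := fun z => by
    rw [hderiv.fderiv]
    rfl
  have hinj : Function.Injective (fderiv ℝ ψ z₀) := by
    refine (injective_iff_map_eq_zero _).2 fun z hz => ?_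
    rw [hdapply] at hz
    have h1 : restrictForm (Gt (Φ x)) (fderiv ℝ f q₀ (L z).1) ((L z).2 : Linf m) = 0 := by
      obtain ⟨c, hc⟩ := Submodule.mem_span_singleton.1 (L z).2.2
      rw [← hc, map_smul, hV, smul_zero]
    have h2 : fderiv ℝ f q₀ (L z).1 = 0 := by
      by_contra hne
      have h3 := H.scalar.self_of_nhds.pos hne
      rw [← H.metric_eq.self_of_nhds, ← restrictForm_apply, hfx] at h3
      have h4 := congrArg (restrictForm (Gt (Φ x)) (fderiv ℝ f q₀ (L z).1)) hz
      rw [map_add, h1, map_zero, add_zero] at h4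
      exact h3.ne' h4
    have h3 : (L z).1 = 0 := by
      rw [← H.leftInverse.self_of_nhds (L z).1, h2, map_zero, map_zero]
    rw [h2, zero_add] at hz
    have h4 : L z = 0 := Prod.ext h3 (Subtype.ext hz)
    exact (map_eq_zero_iff L L.injective).1 h4
  obtain ⟨W, hWo, hzW, hWO, hWi, hWe⟩ :=
    exists_isEmbedding_restrict hO (fun z hz => hψs z hz.1) hinj
  have hσx : σ x = z₀ := rfl
  have hσs : ContMDiffAt (𝓡 (m + 1)) 𝓘(ℝ, EuclideanSpace ℝ (Fin (Module.finrank ℝ X))) ∞ σ x := by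
    have h1 : ContMDiffAt (𝓡 (m + 1)) 𝓘(ℝ, Eucl m) ∞ ch x := contMDiffAt_extChartAt
    have h2 : ContDiff ℝ ∞ fun q : Eucl m => L.symm (q, (0 : N)) :=
      L.symm.contDiff.comp (contDiff_id.prodMk contDiff_const)
    exact h2.contDiffAt.contMDiffAt.comp x h1
  exact ⟨{ k := _, W := W, isOpen := hWo, ψ := ψ
           smooth := fun z hz => (hψs z (hWO hz).1).contDiffWithinAt
           mapsTo := fun z hz => (hWO hz).2
           immersive := hWi, embedding := hWe, σ := σ, σ_smooth := hσs
           σ_mem := hσs.continuousAt.eventually (hWo.mem_nhds hzW)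
           σ_lift := by
             filter_upwards [(chartAt (Eucl m) x).open_source.mem_nhds hx] with y hy
             have : ch.symm (ch y) = y := ch.left_inv (by rwa [hch, extChartAt_source])
             simp [ψ, σ, hf, this]
           Vc := L.symm (0, ⟨V, Submodule.mem_span_singleton_self V⟩)
           tangent := by
             rw [hσx, hdapply]
             simp }⟩

end Chart

/-! ### The mean curvature -/

/-- A scalar product on a finite-dimensional space has an orthonormal basis. -/
theorem exists_orthonormal_basis {m : ℕ} {h : Eucl m →L[ℝ] Eucl m →L[ℝ] ℝ}
    (hs : ∀ a b, h a b = h b a) (hp : ∀ a, a ≠ 0 → 0 < h a a) :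
    ∃ e : Module.Basis (Fin (m + 1)) ℝ (Eucl m), ∀ i j, h (e i) (e j) = if i = j then 1 else 0 := by
  let B : LinearMap.BilinForm ℝ (Eucl m) := (ContinuousLinearMap.coeLM ℝ).comp h.toLinearMap
  have hB : ∀ a b, B a b = h a b := fun _ _ => rfl
  obtain ⟨v, hv⟩ := LinearMap.BilinForm.exists_orthogonal_basis (B := B) ⟨fun a b => hs a b⟩
  let v' := v.reindex (finCongr (by simp : Module.finrank ℝ (Eucl m) = m + 1))
  have hv' : ∀ i j, i ≠ j → h (v' i) (v' j) = 0 := fun i j hij => by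
    have h2 := hv (i := (finCongr (by simp : Module.finrank ℝ (Eucl m) = m + 1)).symm i)
      (j := (finCongr (by simp : Module.finrank ℝ (Eucl m) = m + 1)).symm j)
      (fun h => hij (Equiv.injective _ h))
    simpa [v', Function.onFun, hB] using h2
  have hpos : ∀ i, 0 < h (v' i) (v' i) := fun i => hp _ (v'.ne_zero i)
  have hsq : ∀ i, √(h (v' i) (v' i)) ≠ 0 := fun i => (Real.sqrt_pos.2 (hpos i)).ne'
  refine ⟨v'.unitsSMul fun i => (Units.mk0 _ (hsq i))⁻¹, fun i j => ?_⟩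
  simp only [Module.Basis.unitsSMul_apply, Units.smul_def, Units.val_inv_eq_inv_val, Units.val_mk0,
    map_smul, smul_apply, smul_eq_mul]
  split_ifs with hij
  · subst hij
    have := Real.mul_self_sqrt (hpos i).le
    have hne := (hpos i).ne'
    field_simp
    rw [sq, this, div_self hne]
  · rw [hv' i j hij]
    simp

namespace LocalModel

variable {m : ℕ} {G : Linf m → LForm m} {Gt : Linf m → Ltwo m →L[ℝ] Ltwo m →L[ℝ] ℝ}
  {f : Eucl m → Linf m} {p : Linf m → Eucl m} {D : Linf m → Ltwo m →L[ℝ] Eucl m} {q₀ : Eucl m}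

theorem inducedMetric_symm (H : LocalModel G Gt f p D q₀) :
    ∀ᶠ q in 𝓝 q₀, ∀ a b, inducedMetric Gt f q a b = inducedMetric Gt f q b a := by
  filter_upwards [H.tendsto.eventually H.form_symm] with q hq a b
  exact hq _ _

theorem inducedMetric_pos (H : LocalModel G Gt f p D q₀) :
    ∀ᶠ q in 𝓝 q₀, ∀ a, a ≠ 0 → 0 < inducedMetric Gt f q a a := by
  filter_upwards [H.leftInverse, H.tendsto.eventually H.metric_eq,
    H.tendsto.eventually H.scalar] with q h1 h2 h3 a ha
  have hne : fderiv ℝ f q a ≠ 0 := fun h0 => ha (by rw [← h1 a, h0, map_zero, map_zero])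
  have := h3.pos hne
  rwa [← h2] at this

end LocalModel

/-- The local second fundamental form as a quadratic form. -/
def localSecondQuadraticForm {m : ℕ} (Gt : Linf m → Ltwo m →L[ℝ] Ltwo m →L[ℝ] ℝ)
    (f : Eucl m → Linf m) (q : Eucl m) (V : Linf m) : QuadraticForm ℝ (Eucl m) :=
  LinearMap.BilinMap.toQuadraticMap (LinearMap.mk₂ ℝ (localSecondForm Gt f q V)
    (fun a b c => by simp only [localSecondForm, map_add, add_apply]; ring)
    (fun r a b => by
      simp only [localSecondForm, map_smul, smul_apply, smul_eq_mul]; ring)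
    (fun a b c => by simp only [localSecondForm, map_add, add_apply]; ring)
    (fun r a b => by
      simp only [localSecondForm, map_smul, smul_apply, smul_eq_mul]; ring))

theorem chart_symm_self {m : ℕ} {M : Type*} [TopologicalSpace M] [ChartedSpace (Eucl m) M]
    (Φ : M → Linf m) (x : M) :
    (Φ ∘ (extChartAt (𝓡 (m + 1)) x).symm) (extChartAt (𝓡 (m + 1)) x x) = Φ x := by
  simp

section Chart

variable {m : ℕ} {M : Type*} [TopologicalSpace M] [ChartedSpace (Eucl m) M]
  [IsManifold (𝓡 (m + 1)) ∞ M]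
  {g : Bundle.ContMDiffRiemannianMetric (𝓡 (m + 1)) ∞ (Eucl m)
      (fun x : M => TangentSpace (𝓡 (m + 1)) x)}
  {U : Set (Linf m)} {G : Linf m → LForm m} {Φ : M → Linf m}

theorem fderiv_chart_eq_surfDeriv (hΦ : IsSmoothIsometricImmersion g U G Φ) (x : M)
    (v : TangentSpace (𝓡 (m + 1)) x) :
    fderiv ℝ (Φ ∘ (extChartAt (𝓡 (m + 1)) x).symm) (extChartAt (𝓡 (m + 1)) x x) v =
      surfDeriv Φ x v := by
  have h := fderiv_comp_chart_symm (mem_chart_source _ x) (hΦ.mdifferentiableAt x) v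
  rwa [chartCoord_self] at h

theorem IsNormal.local (hΦ : IsSmoothIsometricImmersion g U G Φ)
    {Gt : Linf m → Ltwo m →L[ℝ] Ltwo m →L[ℝ] ℝ}
    {p : Linf m → Eucl m} {D : Linf m → Ltwo m →L[ℝ] Eucl m} {x : M} {V : Linf m}
    (H : LocalModel G Gt (Φ ∘ (extChartAt (𝓡 (m + 1)) x).symm) p D (extChartAt (𝓡 (m + 1)) x x))
    (hV : IsNormal G Φ x V) (v : Eucl m) :
    restrictForm (Gt (Φ x)) (fderiv ℝ (Φ ∘ (extChartAt (𝓡 (m + 1)) x).symm)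
      (extChartAt (𝓡 (m + 1)) x x) v) V = 0 := by
  have h1 := H.metric_eq.self_of_nhds
  rw [chart_symm_self] at h1
  rw [restrictForm_apply, h1]
  exact hV _ ⟨v, (fderiv_chart_eq_surfDeriv hΦ x v).symm⟩

/-- The trace of the local second fundamental form is the mean curvature. -/
theorem isMeanCurvature_sum (hU : IsOpen U) (hΦ : IsSmoothIsometricImmersion g U G Φ)
    {Gt : Linf m → Ltwo m →L[ℝ] Ltwo m →L[ℝ] ℝ}
    {p : Linf m → Eucl m} {D : Linf m → Ltwo m →L[ℝ] Eucl m} {x : M} {V : Linf m}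
    (H : LocalModel G Gt (Φ ∘ (extChartAt (𝓡 (m + 1)) x).symm) p D (extChartAt (𝓡 (m + 1)) x x))
    (hV : IsNormal G Φ x V) {e : Module.Basis (Fin (m + 1)) ℝ (Eucl m)}
    (he : ∀ i j, inducedMetric Gt (Φ ∘ (extChartAt (𝓡 (m + 1)) x).symm)
      (extChartAt (𝓡 (m + 1)) x x) (e i) (e j) = if i = j then 1 else 0) :
    IsMeanCurvature U G Φ x V (∑ k, localSecondForm Gt (Φ ∘ (extChartAt (𝓡 (m + 1)) x).symm)
      (extChartAt (𝓡 (m + 1)) x x) V (e k) (e k)) := by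
  have hinj : Function.Injective (surfDeriv Φ x).toLinearMap := by
    refine (injective_iff_map_eq_zero _).2 fun v hv => ?_
    by_contra hne
    have h1 := g.pos x v hne
    rw [← hΦ.isometric] at h1
    have h2 : surfDeriv Φ x v = 0 := hv
    rw [h2] at h1
    simp at h1
  let E := LinearEquiv.ofInjective (surfDeriv Φ x).toLinearMap hinj
  have hE : ∀ v, ((E v : surfTangent Φ x) : Linf m) = surfDeriv Φ x v := fun v => rfl
  let Q := localSecondQuadraticForm Gt (Φ ∘ (extChartAt (𝓡 (m + 1)) x).symm)
    (extChartAt (𝓡 (m + 1)) x x) V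
  let II : QuadraticForm ℝ (surfTangent Φ x) :=
    QuadraticMap.comp Q (E.symm.toLinearMap : surfTangent Φ x →ₗ[ℝ] Eucl m)
  have hII : ∀ v, II (E v) = Q v := fun v =>
    congrArg Q (E.symm_apply_apply v)
  refine ⟨II, ⟨nonempty_auxSubmanifold hU hΦ H (hV.local hΦ H), fun F τ hτ => ?_⟩,
    Module.Basis.map e E, fun i j => ?_, ?_⟩
  · rw [covDerivPairing_eq H (hV.local hΦ H) F hτ]
    exact hII (τ x)
  · have h1 := H.metric_eq.self_of_nhds
    rw [chart_symm_self] at h1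
    have h2 : ∀ v : Eucl m, fderiv ℝ (Φ ∘ (extChartAt (𝓡 (m + 1)) x).symm)
        (extChartAt (𝓡 (m + 1)) x x) v = vectorDeriv Φ x v := fderiv_chart_eq_surfDeriv hΦ x
    rw [← he, inducedMetric_apply, chart_symm_self, h2, h2, restrictForm_apply, h1]
    rfl
  · exact Finset.sum_congr rfl fun k _ => (hII (e k)).symm

end Chart

/-! ### The algebra `L^∞` -/

theorem ae_norm_le_norm {m : ℕ} (u : Linf m) : ∀ᵐ s ∂(sphereMeasure m), ‖u s‖ ≤ ‖u‖ := by
  have h : eLpNormEssSup u (sphereMeasure m) = ENNReal.ofReal ‖u‖ := by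
    rw [← eLpNorm_exponent_top, Lp.norm_def, ENNReal.ofReal_toReal (Lp.eLpNorm_ne_top u)]
  filter_upwards [ae_le_eLpNormEssSup (f := u) (μ := sphereMeasure m)] with s hs
  rw [h, ← ofReal_norm] at hs
  exact (ENNReal.ofReal_le_ofReal_iff (norm_nonneg u)).1 hs

theorem integrable_linf {m : ℕ} (u : Linf m) : Integrable u (sphereMeasure m) :=
  (Lp.memLp u).integrable le_top

/-- Multiplication in `L^∞`. -/
def mulL (m : ℕ) : Linf m →L[ℝ] Linf m →L[ℝ] Linf m :=
  (ContinuousLinearMap.mul ℝ ℝ).holderL (sphereMeasure m) ⊤ ⊤ ⊤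

theorem coeFn_mulL {m : ℕ} (u v : Linf m) :
    mulL m u v =ᵐ[sphereMeasure m] fun s => u s * v s :=
  (ContinuousLinearMap.mul ℝ ℝ).coeFn_holder u v

theorem mulL_comm {m : ℕ} (u v : Linf m) : mulL m u v = mulL m v u := by
  refine Lp.ext ?_
  filter_upwards [coeFn_mulL u v, coeFn_mulL v u] with s h1 h2
  rw [h1, h2, mul_comm]

theorem mulL_assoc {m : ℕ} (u v w : Linf m) :
    mulL m (mulL m u v) w = mulL m u (mulL m v w) := by
  refine Lp.ext ?_
  filter_upwards [coeFn_mulL u v, coeFn_mulL (mulL m u v) w, coeFn_mulL v w,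
    coeFn_mulL u (mulL m v w)] with s h1 h2 h3 h4
  rw [h2, h1, h4, h3, mul_assoc]

/-- The coordinates of a map of the sphere to itself satisfy `∑ w_i² = 1`. -/
theorem sum_mulL_self {m : ℕ} {w : Fin (m + 1) → Linf m} {θ : Sph m → Sph m}
    (hw : ∀ j, w j =ᵐ[sphereMeasure m] fun s => (θ s : Eucl m) j) :
    ∑ i, mulL m (w i) (w i) = Lp.const ⊤ (sphereMeasure m) (1 : ℝ) := by
  refine Lp.ext ?_
  have h3 : ∀ᵐ s ∂(sphereMeasure m), ∀ i, mulL m (w i) (w i) s =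
      (θ s : Eucl m) i * (θ s : Eucl m) i := by
    refine ae_all_iff.2 fun i => ?_
    filter_upwards [hw i, coeFn_mulL (w i) (w i)] with s h1 h2
    rw [h2, h1]
  filter_upwards [h3, Lp.coeFn_const (p := ⊤) (sphereMeasure m) (1 : ℝ),
    Lp.coeFn_finsetSum Finset.univ fun i => mulL m (w i) (w i)] with s h4 h5 h6
  rw [h5, h6]
  simp only [Finset.sum_apply, h4, Function.const_apply]
  have h7 : ‖(θ s : Eucl m)‖ = 1 := norm_eq_of_mem_sphere _
  have h8 := EuclideanSpace.real_norm_sq_eq (θ s : Eucl m)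
  rw [h7] at h8
  simpa [sq] using h8.symm

theorem const_one_mulL {m : ℕ} (u : Linf m) :
    mulL m (Lp.const ⊤ (sphereMeasure m) (1 : ℝ)) u = u := by
  refine Lp.ext ?_
  filter_upwards [coeFn_mulL (Lp.const ⊤ (sphereMeasure m) (1 : ℝ)) u,
    Lp.coeFn_const (p := ⊤) (sphereMeasure m) (1 : ℝ)] with s h1 h2
  rw [h1, h2, Function.const_apply, one_mul]

/-- The integral as a continuous linear functional on `L^∞`. -/
def intL (m : ℕ) : Linf m →L[ℝ] ℝ :=
  LinearMap.mkContinuous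
    { toFun := fun u => ∫ s, u s ∂(sphereMeasure m)
      map_add' := fun u v => by
        rw [← integral_add (integrable_linf u) (integrable_linf v)]
        exact integral_congr_ae (Lp.coeFn_add u v)
      map_smul' := fun c u => by
        rw [RingHom.id_apply, smul_eq_mul, ← integral_const_mul]
        exact integral_congr_ae (Lp.coeFn_smul c u) } 1 fun u => by
    simpa using norm_integral_le_of_norm_le_const (ae_norm_le_norm u)

theorem intL_apply {m : ℕ} (u : Linf m) : intL m u = ∫ s, u s ∂(sphereMeasure m) := rfl

theorem HasFDerivAt.mulL {X : Type*} [NormedAddCommGroup X] [NormedSpace ℝ X] {m : ℕ}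
    {u v : X → Linf m} {u' v' : X →L[ℝ] Linf m} {q : X} (hu : HasFDerivAt u u' q)
    (hv : HasFDerivAt v v' q) :
    ∃ d : X →L[ℝ] Linf m, HasFDerivAt (fun x => mulL m (u x) (v x)) d q ∧
      ∀ a, d a = _root_.mulL m (u' a) (v q) + _root_.mulL m (u q) (v' a) := by
  have h := HasFDerivAt.comp (g := _root_.mulL m) q (ContinuousLinearMap.hasFDerivAt _) hu
  refine ⟨_, h.clm_apply hv, fun a => ?_⟩
  rw [add_apply, ContinuousLinearMap.comp_apply, ContinuousLinearMap.flip_apply, add_comm]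
  rfl

/-- A function in `L^∞` that is orthogonal to all functions `K ∘ θ`, where `K` is a polynomial in
the coordinates of the sphere and `θ` a homeomorphism, vanishes. -/
theorem eq_zero_of_integral_adjoin {m : ℕ} (θ : Sph m ≃ₜ Sph m) (R : Linf m)
    {coord : Fin (m + 1) → C(Sph m, ℝ)} (hcoord : ∀ j s, coord j s = (s : Eucl m) j)
    (h : ∀ K ∈ Algebra.adjoin ℝ (range coord),
      ∫ s, K (θ s) * R s ∂(sphereMeasure m) = 0) : R = 0 := by
  let A := Algebra.adjoin ℝ (range coord)
  have hsep : A.SeparatesPoints := by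
    intro s t hst
    have : ∃ j, (s : Eucl m) j ≠ (t : Eucl m) j := by
      by_contra hne
      push Not at hne
      exact hst (Subtype.ext (PiLp.ext hne))
    obtain ⟨j, hj⟩ := this
    refine ⟨coord j, ⟨coord j, Algebra.subset_adjoin (mem_range_self j), rfl⟩, ?_⟩
    rwa [hcoord, hcoord]
  have hA := ContinuousMap.subalgebra_topologicalClosure_eq_top_of_separatesPoints A hsep
  let I : C(Sph m, ℝ) → ℝ := fun K =>
    intL m (mulL m (ContinuousMap.toLp (E := ℝ) ⊤ (sphereMeasure m) ℝ
      (K.comp (θ : C(Sph m, Sph m)))) R)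
  have hIapply : ∀ K, I K = ∫ s, K (θ s) * R s ∂(sphereMeasure m) := fun K => by
    refine integral_congr_ae ?_
    filter_upwards [coeFn_mulL (ContinuousMap.toLp (E := ℝ) ⊤ (sphereMeasure m) ℝ
      (K.comp (θ : C(Sph m, Sph m)))) R, ContinuousMap.coeFn_toLp (p := ⊤) (sphereMeasure m)
        (𝕜 := ℝ) (K.comp (θ : C(Sph m, Sph m)))] with s h1 h2
    rw [h1, h2]
    rfl
  have hIc : Continuous I := by
    have h1 : Continuous fun K : C(Sph m, ℝ) => K.comp (θ : C(Sph m, Sph m)) :=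
      ContinuousMap.continuous_precomp _
    have h2 : Continuous fun u : Linf m => intL m (mulL m u R) :=
      (intL m).continuous.comp ((mulL m).flip R).continuous
    exact h2.comp ((ContinuousMap.toLp (E := ℝ) ⊤ (sphereMeasure m) ℝ).continuous.comp h1)
  have hI : ∀ K, I K = 0 := by
    have hcl : IsClosed {K | I K = 0} := isClosed_eq hIc continuous_const
    have hsub : (A.topologicalClosure : Set C(Sph m, ℝ)) ⊆ {K | I K = 0} :=
      closure_minimal (fun K hK => (hIapply K).trans (h K hK)) hcl
    intro K
    refine hsub ?_
    rw [hA]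
    trivial
  have hae : ∀ᵐ s ∂(sphereMeasure m), R s = 0 := by
    refine ae_eq_zero_of_integral_contMDiff_smul_eq_zero (𝓡 m)
      (integrable_linf R).locallyIntegrable fun k hk _ => ?_
    have := hI ⟨fun s => k (θ.symm s), hk.continuous.comp θ.symm.continuous⟩
    rw [hIapply] at this
    simpa using this
  refine Lp.ext ?_
  filter_upwards [hae, Lp.coeFn_zero ℝ ⊤ (sphereMeasure m)] with s h1 h2
  rw [h1, h2, Pi.zero_apply]

/-! ### The divergence of the density along the gradient fields -/

/-- Let `θ q` be maps of the sphere with coordinates `w j q`, which transport the measures of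
densities `ρ q` to the uniform measure.  If the derivative of `w` is torsion free, that is
`∂_i w_j = ∂_j w_i`, then the divergence `∑ ∂_i (w_i ρ)` vanishes.

The moments `∫ w_i K(w) ρ` do not depend on `q`, for every polynomial `K`.  In the sum over `i` of
their derivatives, the terms with a derivative of `K(w)` cancel, since `∑ w_i ∂_i w_j =
∑ w_i ∂_j w_i = ∂_j |w|² / 2 = 0`. -/
theorem divergence_eq_zero {m : ℕ} {X : Type*} [NormedAddCommGroup X] [NormedSpace ℝ X] {q₀ : X}
    {w : Fin (m + 1) → X → Linf m} {w' : Fin (m + 1) → X →L[ℝ] Linf m}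
    {ρ : X → Linf m} {ρ' : X →L[ℝ] Linf m} {a : Fin (m + 1) → X} {θ : X → Sph m → Sph m}
    (hw : ∀ j, HasFDerivAt (w j) (w' j) q₀) (hρ : HasFDerivAt ρ ρ' q₀)
    (hθ : ∀ᶠ q in 𝓝 q₀, ∀ j, w j q =ᵐ[sphereMeasure m] fun s => (θ q s : Eucl m) j)
    (hmom : ∀ᶠ q in 𝓝 q₀, ∀ (K : C(Sph m, ℝ)) (u : Linf m),
      u =ᵐ[sphereMeasure m] (fun s => K (θ q s)) →
        intL m (mulL m u (ρ q)) = ∫ s, K s ∂(sphereMeasure m))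
    (htors : ∀ i j, w' j (a i) = w' i (a j))
    (hhomeo : ∃ θ₀ : Sph m ≃ₜ Sph m, ∀ s, θ q₀ s = θ₀ s) :
    ∑ i, (mulL m (w' i (a i)) (ρ q₀) + mulL m (w i q₀) (ρ' (a i))) = 0 := by
  obtain ⟨θ₀, hθ₀⟩ := hhomeo
  let coord : Fin (m + 1) → C(Sph m, ℝ) := fun j => ⟨fun s => (s : Eucl m) j, by fun_prop⟩
  have hcoord : ∀ j s, coord j s = (s : Eucl m) j := fun _ _ => rfl
  -- differentiating `|w|² = 1`
  have hunit : ∀ v : X, ∑ i, mulL m (w i q₀) (w' i v) = 0 := by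
    intro v
    choose d hd hde using fun i => (hw i).mulL (hw i)
    have h1 : HasFDerivAt (fun q => ∑ i, mulL m (w i q) (w i q)) (∑ i, d i) q₀ :=
      HasFDerivAt.fun_sum fun i _ => hd i
    have h2 : (fun q => ∑ i, mulL m (w i q) (w i q)) =ᶠ[𝓝 q₀]
        fun _ => Lp.const ⊤ (sphereMeasure m) (1 : ℝ) := by
      filter_upwards [hθ] with q hq using sum_mulL_self hq
    have h3 := h1.unique ((hasFDerivAt_const (Lp.const ⊤ (sphereMeasure m) (1 : ℝ)) q₀
      ).congr_of_eventuallyEq h2)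
    have h4 := congrArg (fun A : X →L[ℝ] Linf m => A v) h3
    simp only [sum_apply, hde, zero_apply] at h4
    have h5 : ∀ i, mulL m (w' i v) (w i q₀) + mulL m (w i q₀) (w' i v) =
        (2 : ℝ) • mulL m (w i q₀) (w' i v) := fun i => by rw [mulL_comm, two_smul]
    simp only [h5, ← Finset.smul_sum] at h4
    exact (smul_eq_zero.1 h4).resolve_left two_ne_zero
  -- polynomials in `w` are constant along the geodesic field, to first order
  have hpoly : ∀ K ∈ Algebra.adjoin ℝ (range coord), ∃ (k : X → Linf m) (k' : X →L[ℝ] Linf m),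
      HasFDerivAt k k' q₀ ∧
      (∀ᶠ q in 𝓝 q₀, k q =ᵐ[sphereMeasure m] fun s => K (θ q s)) ∧
      ∑ i, mulL m (w i q₀) (k' (a i)) = 0 := by
    intro K hK
    induction hK using Algebra.adjoin_induction with
    | mem K hK =>
      obtain ⟨j, rfl⟩ := hK
      refine ⟨w j, w' j, hw j, hθ.mono fun q hq => hq j, ?_⟩
      simp only [htors _ j, hunit]
    | algebraMap r =>
      refine ⟨fun _ => Lp.const ⊤ (sphereMeasure m) r, 0, hasFDerivAt_const _ _,
        Eventually.of_forall fun q => ?_, by simp⟩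
      exact Lp.coeFn_const (p := ⊤) (sphereMeasure m) r
    | add K₁ K₂ _ _ h1 h2 =>
      obtain ⟨k₁, k₁', d1, e1, s1⟩ := h1
      obtain ⟨k₂, k₂', d2, e2, s2⟩ := h2
      refine ⟨_, _, d1.add d2, ?_, ?_⟩
      · filter_upwards [e1, e2] with q h1 h2
        filter_upwards [h1, h2, Lp.coeFn_add (k₁ q) (k₂ q)] with s h3 h4 h5
        simp only [Pi.add_apply] at h5 ⊢
        rw [h5, h3, h4]
        rfl
      · simp only [add_apply, map_add, Finset.sum_add_distrib, s1, s2, add_zero]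
    | mul K₁ K₂ _ _ h1 h2 =>
      obtain ⟨k₁, k₁', d1, e1, s1⟩ := h1
      obtain ⟨k₂, k₂', d2, e2, s2⟩ := h2
      obtain ⟨d, hd, hde⟩ := d1.mulL d2
      refine ⟨_, d, hd, ?_, ?_⟩
      · filter_upwards [e1, e2] with q h1 h2
        filter_upwards [h1, h2, coeFn_mulL (k₁ q) (k₂ q)] with s h3 h4 h5
        rw [h5, h3, h4]
        rfl
      · have h3 : ∀ i, mulL m (w i q₀) (d (a i)) =
            (mulL m).flip (k₂ q₀) (mulL m (w i q₀) (k₁' (a i))) +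
            mulL m (k₁ q₀) (mulL m (w i q₀) (k₂' (a i))) := fun i => by
          rw [hde, map_add, ContinuousLinearMap.flip_apply, mulL_assoc, ← mulL_assoc (w i q₀) (k₁ q₀),
            mulL_comm (w i q₀) (k₁ q₀), mulL_assoc]
        simp only [h3, Finset.sum_add_distrib, ← map_sum, s1, s2, map_zero, add_zero]
  refine eq_zero_of_integral_adjoin θ₀ _ hcoord fun K hK => ?_
  obtain ⟨k, k', hk, hkθ, hsum⟩ := hpoly K hK
  have hint : ∀ i, intL m (mulL m (mulL m (w' i (a i)) (k q₀)) (ρ q₀)) +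
      intL m (mulL m (mulL m (w i q₀) (k' (a i))) (ρ q₀)) +
      intL m (mulL m (mulL m (w i q₀) (k q₀)) (ρ' (a i))) = 0 := by
    intro i
    obtain ⟨d1, hd1, e1⟩ := (hw i).mulL hk
    obtain ⟨d2, hd2, e2⟩ := hd1.mulL hρ
    have h1 : HasFDerivAt (fun q => intL m (mulL m (mulL m (w i q) (k q)) (ρ q)))
        (intL m ∘L d2) q₀ := (intL m).hasFDerivAt.comp q₀ hd2
    have h2 : (fun q => intL m (mulL m (mulL m (w i q) (k q)) (ρ q))) =ᶠ[𝓝 q₀]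
        fun _ => ∫ s, (coord i * K) s ∂(sphereMeasure m) := by
      filter_upwards [hmom, hθ, hkθ] with q h3 h4 h5
      refine h3 (coord i * K) _ ?_
      filter_upwards [coeFn_mulL (w i q) (k q), h4 i, h5] with s h6 h7 h8
      rw [h6, h7, h8]
      rfl
    have h3 := h1.unique ((hasFDerivAt_const _ q₀).congr_of_eventuallyEq h2)
    have h4 := congrArg (fun A : X →L[ℝ] ℝ => A (a i)) h3
    simpa only [ContinuousLinearMap.comp_apply, e2, e1, map_add, add_apply, zero_apply] using h4
  have hR : intL m (mulL m (k q₀)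
      (∑ i, (mulL m (w' i (a i)) (ρ q₀) + mulL m (w i q₀) (ρ' (a i))))) = 0 := by
    have h1 : ∑ i, intL m (mulL m (mulL m (w i q₀) (k' (a i))) (ρ q₀)) = 0 := by
      have : ∀ u, intL m (mulL m u (ρ q₀)) = (intL m ∘L (mulL m).flip (ρ q₀)) u := fun u => rfl
      simp only [this, ← map_sum, hsum, map_zero]
    have h2 := Finset.sum_congr rfl fun i (_ : i ∈ Finset.univ) => hint i
    simp only [Finset.sum_add_distrib, h1, add_zero, Finset.sum_const_zero] at h2
    simp only [map_sum, map_add, Finset.sum_add_distrib]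
    rw [← h2]
    congr 1 <;>
    · refine Finset.sum_congr rfl fun i _ => ?_
      rw [← mulL_assoc, mulL_comm (k q₀)]
  rw [intL_apply] at hR
  rw [← hR]
  refine integral_congr_ae ?_
  filter_upwards [hkθ.self_of_nhds, coeFn_mulL (k q₀)
    (∑ i, (mulL m (w' i (a i)) (ρ q₀) + mulL m (w i q₀) (ρ' (a i))))] with s h1 h2
  rw [h2, h1, hθ₀]

/-! ### Orthonormal frames without torsion -/

/-- Near the identity of a Banach algebra with involution there is a differentiable square root,
which preserves self-adjointness. -/
theorem exists_sqrt_near_one {A : Type*} [NormedRing A] [NormedAlgebra ℝ A] [CompleteSpace A]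
    [StarRing A] [ContinuousStar A] :
    ∃ r : A → A, r 1 = 1 ∧ DifferentiableAt ℝ r 1 ∧
      ∀ᶠ k in 𝓝 (1 : A), r k * r k = k ∧ (star k = k → star (r k) = r k) := by
  let E : A ≃L[ℝ] A := ContinuousLinearEquiv.smulLeft (Units.mk0 (2 : ℝ) two_ne_zero)
  have hE : HasStrictFDerivAt (fun c : A => c * c) (E : A →L[ℝ] A) 1 := by
    have h := (hasStrictFDerivAt_id (𝕜 := ℝ) (1 : A)).mul' (hasStrictFDerivAt_id (𝕜 := ℝ) (1 : A))
    refine h.congr_fderiv ?_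
    ext v
    simp [E, two_smul, Units.smul_def]
  let e := hE.toOpenPartialHomeomorph
  have h1 : (1 : A) ∈ e.source := hE.mem_toOpenPartialHomeomorph_source
  have hr := hE.to_localInverse
  have hr1 : hE.localInverse (fun c : A => c * c) E 1 (1 : A) = 1 := by
    have := hE.localInverse_apply_image
    simpa using this
  rw [mul_one] at hr
  refine ⟨hE.localInverse (fun c : A => c * c) E 1, hr1, hr.hasFDerivAt.differentiableAt, ?_⟩
  have hc : Tendsto (hE.localInverse (fun c : A => c * c) E 1) (𝓝 1) (𝓝 1) := by
    have := hr.continuousAt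
    rwa [ContinuousAt, hr1] at this
  have hsrc : ∀ᶠ c in 𝓝 (1 : A), c ∈ e.source ∧ star c ∈ e.source := by
    have hs : ContinuousAt (star : A → A) 1 := continuous_star.continuousAt
    have h2 : e.source ∈ 𝓝 (star (1 : A)) := by
      rw [star_one]
      exact e.open_source.mem_nhds h1
    filter_upwards [e.open_source.mem_nhds h1, hs.eventually h2] with c h3 h4 using ⟨h3, h4⟩
  have hinv := hE.eventually_right_inverse
  rw [mul_one] at hinv
  filter_upwards [hinv, hc.eventually hsrc] with k hk1 hk2
  refine ⟨hk1, fun hk => e.injOn hk2.2 hk2.1 ?_⟩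
  have h2 := congrArg star hk1
  rw [star_mul, hk] at h2
  exact h2.trans hk1.symm

theorem DifferentiableAt.bilinearComp {X Y E : Type*} [NormedAddCommGroup X] [NormedSpace ℝ X]
    [NormedAddCommGroup Y] [NormedSpace ℝ Y]
    [NormedAddCommGroup E] [NormedSpace ℝ E] {h : X → E →L[ℝ] E →L[ℝ] ℝ} {b : X → Y →L[ℝ] E} {q : X}
    (hh : DifferentiableAt ℝ h q) (hb : DifferentiableAt ℝ b q) :
    DifferentiableAt ℝ (fun x => (h x).bilinearComp (b x) (b x)) q := by
  have h1 : DifferentiableAt ℝ (fun x => ((ContinuousLinearMap.compL ℝ Y E ℝ).flip (b x)) ∘L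
      (h x ∘L b x)) q :=
    ((ContinuousLinearMap.differentiableAt _).comp q hb).clm_comp (hh.clm_comp hb)
  refine h1.congr_of_eventuallyEq (Eventually.of_forall fun x => ?_)
  ext u v
  rfl

theorem HasFDerivAt.comp_of_zero {X Y Z : Type*} [NormedAddCommGroup X] [NormedSpace ℝ X]
    [NormedAddCommGroup Y] [NormedSpace ℝ Y] [NormedAddCommGroup Z] [NormedSpace ℝ Z]
    {g : Y → Z} {k : X → Y} {q : X} (hk : HasFDerivAt k (0 : X →L[ℝ] Y) q)
    (hg : DifferentiableAt ℝ g (k q)) : HasFDerivAt (fun x => g (k x)) (0 : X →L[ℝ] Z) q := by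
  have h := hg.hasFDerivAt.comp q hk
  rwa [ContinuousLinearMap.comp_zero] at h

/-- The vector that represents a functional on Euclidean space. -/
def euclRiesz (m : ℕ) : (Eucl m →L[ℝ] ℝ) →L[ℝ] Eucl m :=
  ∑ i, (ContinuousLinearMap.apply ℝ ℝ (EuclideanSpace.single i (1 : ℝ))).smulRight
    (EuclideanSpace.single i (1 : ℝ))

theorem euclRiesz_apply {m : ℕ} (ℓ : Eucl m →L[ℝ] ℝ) (j : Fin (m + 1)) :
    euclRiesz m ℓ j = ℓ (EuclideanSpace.single j 1) := by
  simp [euclRiesz, Pi.single_apply]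

theorem inner_euclRiesz {m : ℕ} (ℓ : Eucl m →L[ℝ] ℝ) (v : Eucl m) :
    inner ℝ (euclRiesz m ℓ) v = ℓ v := by
  have h := (EuclideanSpace.basisFun (Fin (m + 1)) ℝ).sum_repr v
  conv_rhs => rw [← h]
  simp [PiLp.inner_apply, euclRiesz_apply]

/-- The Christoffel symbols of a metric at a point, in an orthonormal frame `A₀`. -/
theorem exists_christoffel_frame {m : ℕ} (h' : Eucl m →L[ℝ] Eucl m →L[ℝ] Eucl m →L[ℝ] ℝ)
    (hsd : ∀ w u v, h' w u v = h' w v u) (A₀ : Eucl m →L[ℝ] Eucl m) :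
    ∃ α : Eucl m →L[ℝ] Eucl m →L[ℝ] Eucl m, (∀ u v, α u v = α v u) ∧
      ∀ z u v, inner ℝ (α z u) v + inner ℝ (α z v) u = -h' (A₀ z) (A₀ u) (A₀ v) := by
  let κ : Eucl m → Eucl m → Eucl m →L[ℝ] ℝ := fun u v =>
    (1 / 2 : ℝ) • ((h' (A₀ u) (A₀ v) + h' (A₀ v) (A₀ u)) ∘L A₀
      - ((h'.flip (A₀ u)).flip (A₀ v)) ∘L A₀)
  have hκ : ∀ u v z, κ u v z = (1 / 2) * (h' (A₀ u) (A₀ v) (A₀ z) + h' (A₀ v) (A₀ u) (A₀ z)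
      - h' (A₀ z) (A₀ u) (A₀ v)) := fun u v z => by simp [κ]
  let αl : Eucl m →ₗ[ℝ] Eucl m →ₗ[ℝ] Eucl m := LinearMap.mk₂ ℝ (fun u v => -euclRiesz m (κ u v))
    (fun u u' v => by
      rw [← neg_add, ← map_add]
      congr 2
      ext z
      simp only [hκ, add_apply, map_add]
      ring)
    (fun c u v => by
      rw [smul_neg, ← map_smul]
      congr 2
      ext z
      simp only [hκ, smul_apply, map_smul, smul_eq_mul]
      ring)
    (fun u v v' => by
      rw [← neg_add, ← map_add]
      congr 2
      ext z
      simp only [hκ, add_apply, map_add]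
      ring)
    (fun c u v => by
      rw [smul_neg, ← map_smul]
      congr 2
      ext z
      simp only [hκ, smul_apply, map_smul, smul_eq_mul]
      ring)
  refine ⟨LinearMap.toContinuousLinearMap ((LinearMap.toContinuousLinearMap (𝕜 := ℝ)
    (E := Eucl m) (F' := Eucl m)).toLinearMap ∘ₗ αl), fun u v => ?_, fun z u v => ?_⟩
  · change -euclRiesz m (κ u v) = -euclRiesz m (κ v u)
    congr 2
    ext z
    rw [hκ, hκ, hsd (A₀ z) (A₀ u)]
    ring
  · change inner ℝ (-euclRiesz m (κ z u)) v + inner ℝ (-euclRiesz m (κ z v)) u = _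
    rw [inner_neg_left, inner_euclRiesz, inner_neg_left, inner_euclRiesz, hκ, hκ,
      hsd (A₀ z) (A₀ v) (A₀ u), hsd (A₀ v) (A₀ z), hsd (A₀ u) (A₀ z)]
    ring

/-- A family of symmetric operators that is the identity to first order is made the identity by a
change of frame that is trivial to first order: the inverse of the square root. -/
theorem exists_frame_correction {m : ℕ} {k : Eucl m → Eucl m →L[ℝ] Eucl m} {q₀ : Eucl m}
    (hk0 : k q₀ = 1) (hk' : HasFDerivAt k (0 : Eucl m →L[ℝ] Eucl m →L[ℝ] Eucl m) q₀)
    (hks : ∀ᶠ q in 𝓝 q₀, star (k q) = k q) :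
    ∃ c : Eucl m → Eucl m →L[ℝ] Eucl m, c q₀ = 1 ∧
      HasFDerivAt c (0 : Eucl m →L[ℝ] Eucl m →L[ℝ] Eucl m) q₀ ∧
      ∀ᶠ q in 𝓝 q₀, ∀ u v, inner ℝ (k q (c q u)) (c q v) = inner ℝ u v := by
  obtain ⟨r, hr1, hrd, hr⟩ := exists_sqrt_near_one (A := Eucl m →L[ℝ] Eucl m)
  have hs' : HasFDerivAt (fun q => r (k q)) (0 : Eucl m →L[ℝ] Eucl m →L[ℝ] Eucl m) q₀ :=
    hk'.comp_of_zero (by rw [hk0]; exact hrd)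
  have hs0 : r (k q₀) = 1 := by rw [hk0, hr1]
  have hi : DifferentiableAt ℝ (Ring.inverse : (Eucl m →L[ℝ] Eucl m) → _) (r (k q₀)) := by
    rw [hs0]
    exact (hasFDerivAt_ringInverse (𝕜 := ℝ) (1 : (Eucl m →L[ℝ] Eucl m)ˣ)).differentiableAt
  refine ⟨fun q => Ring.inverse (r (k q)), (congrArg Ring.inverse hs0).trans (Ring.inverse_one _),
    hs'.comp_of_zero hi, ?_⟩
  have hunit : ∀ᶠ q in 𝓝 q₀, IsUnit (r (k q)) := by
    refine hs'.continuousAt.eventually (Units.isOpen.mem_nhds ?_)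
    change IsUnit (r (k q₀))
    rw [hs0]
    exact isUnit_one
  have hkt : Tendsto k (𝓝 q₀) (𝓝 1) := by
    have := hk'.continuousAt
    rwa [ContinuousAt, hk0] at this
  filter_upwards [hunit, hks, hkt.eventually hr] with q h1 h2 h3 u v
  have h4 : ∀ u, r (k q) (Ring.inverse (r (k q)) u) = u := fun u =>
    congrArg (fun A : Eucl m →L[ℝ] Eucl m => A u) (Ring.mul_inverse_cancel _ h1)
  generalize Ring.inverse (r (k q)) = c at h4
  have h5 : star (r (k q)) = r (k q) := h3.2 h2
  have h6 : k q (c u) = r (k q) u := by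
    have := congrArg (fun A : Eucl m →L[ℝ] Eucl m => A (c u)) h3.1
    exact this.symm.trans (congrArg (r (k q)) (h4 u))
  have h7 : inner ℝ (r (k q) u) (c v) = inner ℝ u (r (k q) (c v)) := by
    have := ContinuousLinearMap.adjoint_inner_left (r (k q)) (c v) u
    rwa [← ContinuousLinearMap.star_eq_adjoint, h5] at this
  rw [h6, h7, h4]

/-- A metric `h` with an orthonormal frame `A₀` at `q₀` has orthonormal frames `a q` near `q₀` whose
derivative at `q₀` is that of parallel transport; in particular it is symmetric. -/
theorem exists_torsionFree_frame {m : ℕ} {h : Eucl m → Eucl m →L[ℝ] Eucl m →L[ℝ] ℝ} {q₀ : Eucl m}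
    (hd : DifferentiableAt ℝ h q₀) (hs : ∀ᶠ q in 𝓝 q₀, ∀ u v, h q u v = h q v u)
    {A₀ : Eucl m ≃L[ℝ] Eucl m} (hA : ∀ u v, h q₀ (A₀ u) (A₀ v) = inner ℝ u v) :
    ∃ (a : Eucl m → Eucl m →L[ℝ] Eucl m) (a' : Eucl m →L[ℝ] Eucl m →L[ℝ] Eucl m),
      HasFDerivAt a a' q₀ ∧ a q₀ = A₀ ∧
      (∀ᶠ q in 𝓝 q₀, ∀ u v, h q (a q u) (a q v) = inner ℝ u v) ∧
      ∀ u v, a' (A₀ u) v = a' (A₀ v) u := by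
  have hsd : ∀ w u v, fderiv ℝ h q₀ w u v = fderiv ℝ h q₀ w v u := by
    intro w u v
    have h1 : ∀ x y, HasFDerivAt (fun q => h q x y) _ q₀ := fun x y =>
      (hd.hasFDerivAt.clm_apply (hasFDerivAt_const x q₀)).clm_apply (hasFDerivAt_const y q₀)
    have h2 := (h1 u v).unique ((h1 v u).congr_of_eventuallyEq (hs.mono fun q hq => hq u v))
    have h3 := congrArg (fun A : Eucl m →L[ℝ] ℝ => A w) h2
    simpa using h3
  obtain ⟨α, hαs, hαm⟩ := exists_christoffel_frame (fderiv ℝ h q₀) hsd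
    (A₀ : Eucl m →L[ℝ] Eucl m)
  -- frames that are orthonormal to first order
  let b : Eucl m → Eucl m →L[ℝ] Eucl m := fun q =>
    (A₀ : Eucl m →L[ℝ] Eucl m) ∘L (ContinuousLinearMap.id ℝ (Eucl m) + α (A₀.symm (q - q₀)))
  let b' : Eucl m →L[ℝ] Eucl m →L[ℝ] Eucl m :=
    (ContinuousLinearMap.postcomp (Eucl m) (A₀ : Eucl m →L[ℝ] Eucl m)) ∘L
      (α ∘L (A₀.symm : Eucl m →L[ℝ] Eucl m))
  have hb : HasFDerivAt b b' q₀ := by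
    have h1 : HasFDerivAt (fun q => ContinuousLinearMap.id ℝ (Eucl m) + α (A₀.symm (q - q₀)))
        (α ∘L (A₀.symm : Eucl m →L[ℝ] Eucl m)) q₀ := by
      have h2 : HasFDerivAt (fun q => q - q₀) (ContinuousLinearMap.id ℝ (Eucl m)) q₀ :=
        (hasFDerivAt_id q₀).sub_const q₀
      have h3 := HasFDerivAt.comp (g := (α ∘L (A₀.symm : Eucl m →L[ℝ] Eucl m))) q₀
        (ContinuousLinearMap.hasFDerivAt _) h2
      exact h3.const_add _
    exact HasFDerivAt.comp (g := ContinuousLinearMap.postcomp (Eucl m)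
      (A₀ : Eucl m →L[ℝ] Eucl m)) q₀ (ContinuousLinearMap.hasFDerivAt _) h1
  have hb0 : b q₀ = A₀ := by
    ext1 v
    simp [b]
  have hb' : ∀ w v, b' w v = A₀ (α (A₀.symm w) v) := fun w v => rfl
  -- their Gram operator
  let k : Eucl m → Eucl m →L[ℝ] Eucl m := fun q =>
    euclRiesz m ∘L (h q).bilinearComp (b q) (b q)
  have hki : ∀ q u v, inner ℝ (k q u) v = h q (b q u) (b q v) := fun q u v =>
    inner_euclRiesz _ _
  have hk0 : k q₀ = 1 := by
    ext1 u
    refine ext_inner_right ℝ fun v => ?_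
    rw [hki, hb0]
    exact hA u v
  have hkd : DifferentiableAt ℝ k q₀ :=
    (differentiableAt_const _).clm_comp (hd.bilinearComp hb.differentiableAt)
  have hk0' : ∀ w u v, inner ℝ (fderiv ℝ k q₀ w u) v = 0 := by
    intro w u v
    have h1 : HasFDerivAt (fun q => innerSL ℝ v (k q u))
        (innerSL ℝ v ∘L (fderiv ℝ k q₀).flip u) q₀ := by
      have := hkd.hasFDerivAt.clm_apply (hasFDerivAt_const u q₀)
      refine (HasFDerivAt.comp (g := innerSL ℝ v) q₀ (ContinuousLinearMap.hasFDerivAt _)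
        this).congr_fderiv ?_
      ext1 w
      simp
    obtain ⟨d, hd2, e⟩ := hd.hasFDerivAt.clm_apply₂ (hb.clm_apply (hasFDerivAt_const u q₀))
      (hb.clm_apply (hasFDerivAt_const v q₀))
    have h2 := h1.unique (hd2.congr_of_eventuallyEq
      (Eventually.of_forall fun q => (real_inner_comm _ _).trans (hki q u v)))
    have h3 : innerSL ℝ v (fderiv ℝ k q₀ w u) = d w :=
      congrArg (fun A : Eucl m →L[ℝ] ℝ => A w) h2
    rw [innerSL_apply_apply, real_inner_comm, e] at h3
    rw [h3]
    obtain ⟨z, rfl⟩ := A₀.surjective w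
    have h4 := hαm z u v
    simp only [ContinuousLinearEquiv.coe_coe] at h4
    simp [hb0, hb', hA, real_inner_comm (α z v) u]
    linarith
  have hk' : HasFDerivAt k (0 : Eucl m →L[ℝ] Eucl m →L[ℝ] Eucl m) q₀ := by
    refine hkd.hasFDerivAt.congr_fderiv ?_
    ext1 w
    ext1 u
    exact ext_inner_right ℝ fun v => (hk0' w u v).trans (inner_zero_left v).symm
  have hks : ∀ᶠ q in 𝓝 q₀, star (k q) = k q := by
    filter_upwards [hs] with q hq
    refine ((ContinuousLinearMap.eq_adjoint_iff _ _).2 fun u v => ?_).symm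
    rw [hki, real_inner_comm, hki, hq]
  obtain ⟨c, hc0, hc', hc⟩ := exists_frame_correction hk0 hk' hks
  refine ⟨fun q => b q ∘L c q, b', ?_, ?_, ?_, ?_⟩
  · refine (hb.clm_comp hc').congr_fderiv ?_
    ext1 w
    ext1 v
    simp [hc0]
  · change b q₀ ∘L c q₀ = A₀
    rw [hc0, hb0]
    rfl
  · filter_upwards [hc] with q hq u v
    exact (hki _ _ _).symm.trans (hq u v)
  · intro u v
    rw [hb', hb', A₀.symm_apply_apply, A₀.symm_apply_apply, hαs]

/-! ### Minimality for special metrics, in local coordinates -/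

/-- The linear isometry from Euclidean space that is given by an orthonormal basis. -/
theorem exists_frame_of_basis {m : ℕ} {h : Eucl m →L[ℝ] Eucl m →L[ℝ] ℝ}
    {e : Module.Basis (Fin (m + 1)) ℝ (Eucl m)}
    (he : ∀ i j, h (e i) (e j) = if i = j then 1 else 0) :
    ∃ A₀ : Eucl m ≃L[ℝ] Eucl m, (∀ i, A₀ (EuclideanSpace.single i 1) = e i) ∧
      ∀ u v, h (A₀ u) (A₀ v) = inner ℝ u v := by
  let b := (EuclideanSpace.basisFun (Fin (m + 1)) ℝ).toBasis
  let A₀ : Eucl m ≃L[ℝ] Eucl m := (b.equiv e (Equiv.refl _)).toContinuousLinearEquiv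
  have h1 : ∀ i, A₀ (EuclideanSpace.single i 1) = e i := fun i => by
    have := b.equiv_apply i e (Equiv.refl _)
    simp only [b, OrthonormalBasis.coe_toBasis, EuclideanSpace.basisFun_apply] at this
    exact this
  refine ⟨A₀, h1, fun u v => ?_⟩
  have h2 : ∀ u : Eucl m, A₀ u = ∑ i, u i • e i := fun u => by
    have h3 := (EuclideanSpace.basisFun (Fin (m + 1)) ℝ).sum_repr u
    conv_lhs => rw [← h3]
    simp [h1]
  rw [h2, h2]
  simp [he, PiLp.inner_apply, mul_comm]

namespace LocalModel

variable {m : ℕ} {G : Linf m → LForm m} {Gt : Linf m → Ltwo m →L[ℝ] Ltwo m →L[ℝ] ℝ}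
  {f : Eucl m → Linf m} {p : Linf m → Eucl m} {D : Linf m → Ltwo m →L[ℝ] Eucl m} {q₀ : Eucl m}

/-- The trace of the second fundamental form vanishes if the metric is `n ∫ X Y ρ` and, in every
orthonormal frame, the derivatives of `f` are the coordinates of a homeomorphism of the sphere that
takes the measure with density `ρ` to the uniform measure.

Indeed, the trace is `n ∫ V R - (n / 2) ∫ D_V ρ`, where `R` is the divergence of the density along
the gradients. -/
theorem sum_localSecondForm_eq_zero (H : LocalModel G Gt f p D q₀) {n : ℝ}
    {ρ : Linf m → Linf m} (hρ : DifferentiableAt ℝ ρ (f q₀))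
    (hmet : ∀ᶠ φ in 𝓝 (f q₀), ∀ X Y, restrictForm (Gt φ) X Y =
      n * intL m (mulL m (mulL m X Y) (ρ φ)))
    (hone : ∀ᶠ φ in 𝓝 (f q₀), intL m (ρ φ) = 1)
    (hspec : ∀ᶠ q in 𝓝 q₀, ∀ A : Eucl m →L[ℝ] Eucl m,
      (∀ u v, inducedMetric Gt f q (A u) (A v) = inner ℝ u v) →
      ∃ θ : Sph m ≃ₜ Sph m,
        (∀ j, fderiv ℝ f q (A (EuclideanSpace.single j 1)) =ᵐ[sphereMeasure m]
          fun s => (θ s : Eucl m) j) ∧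
        ∀ (K : C(Sph m, ℝ)) (u : Linf m), u =ᵐ[sphereMeasure m] (fun s => K (θ s)) →
          intL m (mulL m u (ρ (f q))) = ∫ s, K s ∂(sphereMeasure m))
    {e : Module.Basis (Fin (m + 1)) ℝ (Eucl m)}
    (he : ∀ i j, inducedMetric Gt f q₀ (e i) (e j) = if i = j then 1 else 0) {V : Linf m}
    (hV : ∀ v, restrictForm (Gt (f q₀)) (fderiv ℝ f q₀ v) V = 0) :
    ∑ k, localSecondForm Gt f q₀ V (e k) (e k) = 0 := by
  obtain ⟨A₀, hA₀e, hA₀⟩ := exists_frame_of_basis he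
  obtain ⟨a, a', ha, ha0, hai, has⟩ := exists_torsionFree_frame
    (H.hasFDerivAt_metric_comp.differentiableAt.bilinearComp H.hasFDerivAt_fderiv.differentiableAt)
    H.inducedMetric_symm hA₀
  set ρ' := fderiv ℝ ρ (f q₀) with hρ'
  have hf := H.eventually_differentiableAt.self_of_nhds.hasFDerivAt
  -- the derivatives of `f` in the direction of the frame
  let ε : Fin (m + 1) → Eucl m := fun j => EuclideanSpace.single j 1
  have haε : ∀ j, a q₀ (ε j) = e j := fun j => by
    rw [ha0]
    exact hA₀e j
  let w : Fin (m + 1) → Eucl m → Linf m := fun j q => fderiv ℝ f q (a q (ε j))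
  have hw : ∀ j, ∃ d : Eucl m →L[ℝ] Linf m, HasFDerivAt (w j) d q₀ ∧ ∀ v,
      d v = fderiv ℝ (fderiv ℝ f) q₀ v (e j) + fderiv ℝ f q₀ (a' v (ε j)) := by
    intro j
    refine ⟨_, H.hasFDerivAt_fderiv.clm_apply (ha.clm_apply (hasFDerivAt_const (ε j) q₀)),
      fun v => ?_⟩
    change fderiv ℝ f q₀ (a q₀ 0 + a' v (ε j)) + fderiv ℝ (fderiv ℝ f) q₀ v (a q₀ (ε j)) = _
    rw [map_zero, zero_add, haε, add_comm]
  choose w' hw' hw'e using hw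
  have hw0 : ∀ j, w j q₀ = fderiv ℝ f q₀ (e j) := fun j => congrArg _ (haε j)
  have hsp : ∀ᶠ q in 𝓝 q₀, ∃ θ : Sph m ≃ₜ Sph m,
      (∀ j, w j q =ᵐ[sphereMeasure m] fun s => (θ s : Eucl m) j) ∧
      ∀ (K : C(Sph m, ℝ)) (u : Linf m), u =ᵐ[sphereMeasure m] (fun s => K (θ s)) →
        intL m (mulL m u (ρ (f q))) = ∫ s, K s ∂(sphereMeasure m) := by
    filter_upwards [hspec, hai] with q h1 h2 using h1 (a q) h2
  have : ∃ θ : Eucl m → Sph m ≃ₜ Sph m, ∀ᶠ q in 𝓝 q₀,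
      (∀ j, w j q =ᵐ[sphereMeasure m] fun s => (θ q s : Eucl m) j) ∧
      ∀ (K : C(Sph m, ℝ)) (u : Linf m), u =ᵐ[sphereMeasure m] (fun s => K (θ q s)) →
        intL m (mulL m u (ρ (f q))) = ∫ s, K s ∂(sphereMeasure m) := hsp.choice
  obtain ⟨θ, hθ⟩ := this
  have hdiv := divergence_eq_zero (a := e) (θ := fun q s => θ q s) hw'
    (hρ.hasFDerivAt.comp q₀ hf) (hθ.mono fun q h => h.1) (hθ.mono fun q h => h.2)
    (fun i j => by
      rw [hw'e, hw'e, H.second_deriv_symm, ← hA₀e i, ← hA₀e j, has]) ⟨θ q₀, fun _ => rfl⟩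
  have hsq := sum_mulL_self hθ.self_of_nhds.1
  simp only [hw0, ContinuousLinearMap.comp_apply, Function.comp_apply] at hdiv hsq
  -- the derivatives of the metric and of the total mass
  have hmet' : ∀ Z X Y, fderiv ℝ (fun φ => restrictForm (Gt φ)) (f q₀) Z X Y =
      n * intL m (mulL m (mulL m X Y) (ρ' Z)) := by
    intro Z X Y
    obtain ⟨d, hd, hde⟩ := H.hasFDerivAt_metric.clm_apply₂ (hasFDerivAt_const X (f q₀))
      (hasFDerivAt_const Y (f q₀))
    have h1 : HasFDerivAt (fun φ => (n • (intL m ∘L mulL m (mulL m X Y))) (ρ φ))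
        ((n • (intL m ∘L mulL m (mulL m X Y))) ∘L ρ') (f q₀) :=
      HasFDerivAt.comp (g := (n • (intL m ∘L mulL m (mulL m X Y)))) (f q₀)
        (ContinuousLinearMap.hasFDerivAt _) hρ.hasFDerivAt
    have h2 := hd.unique (h1.congr_of_eventuallyEq (hmet.mono fun φ hφ => hφ X Y))
    have h3 := congrArg (fun A : Linf m →L[ℝ] ℝ => A Z) h2
    simp only [hde, zero_apply, map_zero, add_zero] at h3
    exact h3
  have hone' : intL m (ρ' V) = 0 := by
    have h1 : HasFDerivAt (fun φ => intL m (ρ φ)) (intL m ∘L ρ') (f q₀) :=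
      HasFDerivAt.comp (g := intL m) (f q₀) (ContinuousLinearMap.hasFDerivAt _) hρ.hasFDerivAt
    have h2 := h1.unique ((hasFDerivAt_const (1 : ℝ) (f q₀)).congr_of_eventuallyEq hone)
    exact congrArg (fun A : Linf m →L[ℝ] ℝ => A V) h2
  have hform : ∀ k, localSecondForm Gt f q₀ V (e k) (e k) =
      n * intL m (mulL m V (mulL m (w' k (e k)) (ρ (f q₀)) +
        mulL m (fderiv ℝ f q₀ (e k)) (ρ' (fderiv ℝ f q₀ (e k))))) -
      n / 2 * intL m (mulL m (mulL m (fderiv ℝ f q₀ (e k)) (fderiv ℝ f q₀ (e k))) (ρ' V)) := by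
    intro k
    have h1 : restrictForm (Gt (f q₀)) (fderiv ℝ (fderiv ℝ f) q₀ (e k) (e k)) V =
        n * intL m (mulL m V (mulL m (w' k (e k)) (ρ (f q₀)))) := by
      have h2 := congrArg (fun X => restrictForm (Gt (f q₀)) X V) (hw'e k (e k))
      simp only [map_add, add_apply, hV, add_zero] at h2
      rw [← h2, hmet.self_of_nhds, mulL_comm _ V, mulL_assoc]
    rw [localSecondForm, h1, hmet', hmet', mulL_comm _ V, mulL_assoc, map_add, map_add]
    ring
  simp only [hform, Finset.sum_sub_distrib, ← Finset.mul_sum, ← map_sum]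
  rw [hdiv]
  have h2 : ∑ k, intL m (mulL m (mulL m (fderiv ℝ f q₀ (e k)) (fderiv ℝ f q₀ (e k))) (ρ' V)) = 0 := by
    have h3 : ∀ u, intL m (mulL m u (ρ' V)) = (intL m ∘L (mulL m).flip (ρ' V)) u := fun u => rfl
    simp only [h3, ← map_sum, hsq]
    rw [← h3, const_one_mulL, hone']
  simp [h2]

end LocalModel

/-! ### Special embeddings and special metrics in a chart -/

/-- The derivative of a map to `L^∞` is given almost everywhere by the derivatives of its
representing functions. -/
theorem fderiv_ae_eq {X : Type*} [NormedAddCommGroup X] [NormedSpace ℝ X] {m : ℕ}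
    {f : X → Linf m} {F : Sph m → X → ℝ} {F' : Sph m → X →L[ℝ] ℝ} {q : X}
    (hf : ∀ q, f q =ᵐ[sphereMeasure m] fun s => F s q) (hd : DifferentiableAt ℝ f q)
    (hF : ∀ s, HasFDerivAt (F s) (F' s) q) (v : X) :
    fderiv ℝ f q v =ᵐ[sphereMeasure m] fun s => F' s v := by
  let c : ℕ → ℝ := fun k => k
  have hc : Tendsto (fun k => ‖c k‖) atTop atTop :=
    tendsto_norm_atTop_atTop.comp tendsto_natCast_atTop_atTop
  let Q : ℕ → Linf m := fun k => c k • (f (q + (c k)⁻¹ • v) - f q)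
  have hQ : Tendsto (fun k => ‖Q k - fderiv ℝ f q v‖) atTop (𝓝 0) :=
    tendsto_iff_norm_sub_tendsto_zero.1 (hd.hasFDerivAt.lim v hc)
  have h1 : ∀ᵐ s ∂(sphereMeasure m), ∀ k,
      ‖c k • (F s (q + (c k)⁻¹ • v) - F s q) - fderiv ℝ f q v s‖ ≤ ‖Q k - fderiv ℝ f q v‖ := by
    refine ae_all_iff.2 fun k => ?_
    filter_upwards [ae_norm_le_norm (Q k - fderiv ℝ f q v), Lp.coeFn_sub (Q k) (fderiv ℝ f q v),
      Lp.coeFn_smul (c k) (f (q + (c k)⁻¹ • v) - f q),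
      Lp.coeFn_sub (f (q + (c k)⁻¹ • v)) (f q), hf (q + (c k)⁻¹ • v), hf q]
      with s h1 h2 h3 h4 h5 h6
    rw [h2, Pi.sub_apply, h3, Pi.smul_apply, h4, Pi.sub_apply, h5, h6] at h1
    exact h1
  filter_upwards [h1] with s hs
  refine tendsto_nhds_unique ?_ ((hF s).lim v hc)
  exact tendsto_iff_norm_sub_tendsto_zero.2 (squeeze_zero (fun _ => norm_nonneg _) hs hQ)

theorem integral_densityMeasure {m : ℕ} {ρ : Linf m} (hρ : ∀ᵐ s ∂(sphereMeasure m), 0 ≤ ρ s)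
    (k : Sph m → ℝ) :
    ∫ s, k s ∂(densityMeasure ρ) = ∫ s, k s * ρ s ∂(sphereMeasure m) := by
  have h1 : AEMeasurable (fun s => ENNReal.ofReal (ρ s)) (sphereMeasure m) :=
    (Lp.aestronglyMeasurable ρ).aemeasurable.ennreal_ofReal
  rw [densityMeasure, integral_withDensity_eq_integral_toReal_smul₀ h1
    (Eventually.of_forall fun _ => ENNReal.ofReal_lt_top)]
  refine integral_congr_ae ?_
  filter_upwards [hρ] with s hs
  rw [ENNReal.toReal_ofReal hs, smul_eq_mul, mul_comm]

section Chart

variable {m : ℕ} {M : Type*} [TopologicalSpace M] [ChartedSpace (Eucl m) M]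
  [IsManifold (𝓡 (m + 1)) ∞ M]
  {g : Bundle.ContMDiffRiemannianMetric (𝓡 (m + 1)) ∞ (Eucl m)
      (fun x : M => TangentSpace (𝓡 (m + 1)) x)}
  {U : Set (Linf m)} {G : Linf m → LForm m} {Φ : M → Linf m}

theorem IsSpecialEmbedding.mdifferentiableAt {Φs : Sph m → M → ℝ}
    (h : IsSpecialEmbedding g Φ Φs) (s : Sph m) (y : M) :
    MDifferentiableAt (𝓡 (m + 1)) 𝓘(ℝ, ℝ) (Φs s) y := by
  have h1 : ContMDiff (𝓡 (m + 1)) ((𝓡 (m + 1)).prod (𝓡 m)) ∞ (fun y : M => (y, s)) :=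
    contMDiff_id.prodMk contMDiff_const
  exact ((h.smooth.comp h1) y).mdifferentiableAt (by simp)

theorem inner_riemGrad (F : M → ℝ) (x : M) (v : TangentSpace (𝓡 (m + 1)) x) :
    g.inner x (riemGrad g F x) v = vectorDeriv F x v :=
  Classical.choose_spec (exists_gradient g F x) v

theorem exists_isFrame {x y : M} (A : Eucl m →L[ℝ] Eucl m)
    (hA : ∀ u v : Eucl m, g.inner y (chartVec x y (A u)) (chartVec x y (A v)) = inner ℝ u v) :
    ∃ A' : Eucl m ≃L[ℝ] TangentSpace (𝓡 (m + 1)) y, IsFrame g y A' ∧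
      ∀ u, A' u = chartVec x y (A u) := by
  let L : Eucl m →ₗ[ℝ] Eucl m := ((chartVec x y : Eucl m →L[ℝ] Eucl m) ∘L A).toLinearMap
  have hL : Function.Injective L := by
    refine (injective_iff_map_eq_zero _).2 fun u hu => ?_
    have h1 := hA u u
    have h2 : chartVec x y (A u) = 0 := hu
    rw [h2, map_zero] at h1
    exact inner_self_eq_zero.1 h1.symm
  let A' : Eucl m ≃L[ℝ] Eucl m := (LinearEquiv.ofInjectiveEndo L hL).toContinuousLinearEquiv
  have hA' : ∀ u, A' u = L u := fun u => rfl
  refine ⟨A', fun u v => ?_, hA'⟩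
  exact hA u v

/-- In an orthonormal frame, the derivatives of a special embedding are the coordinates of a
homeomorphism of the sphere, which takes the measure `μ_y` to the uniform measure. -/
theorem exists_homeomorph_of_special_embedding {Φs : Sph m → M → ℝ} (hΦ : IsSmoothIsometricImmersion g U G Φ)
    (hs : IsSpecialEmbedding g Φ Φs) {x y : M} (hy : y ∈ (chartAt (Eucl m) x).source)
    {ρ : Linf m} (hρ : ∀ᵐ s ∂(sphereMeasure m), 0 ≤ ρ s)
    (hα : IsAlphaPushforward g Φs y (densityMeasure ρ)) {A : Eucl m →L[ℝ] Eucl m}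
    (hA : ∀ u v : Eucl m, g.inner y (chartVec x y (A u)) (chartVec x y (A v)) = inner ℝ u v) :
    ∃ θ : Sph m ≃ₜ Sph m,
      (∀ j, fderiv ℝ (Φ ∘ (extChartAt (𝓡 (m + 1)) x).symm) (extChartAt (𝓡 (m + 1)) x y)
        (A (EuclideanSpace.single j 1)) =ᵐ[sphereMeasure m] fun s => (θ s : Eucl m) j) ∧
      ∀ (K : C(Sph m, ℝ)) (u : Linf m), u =ᵐ[sphereMeasure m] (fun s => K (θ s)) →
        intL m (mulL m u ρ) = ∫ s, K s ∂(sphereMeasure m) := by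
  obtain ⟨A', hA', hA'e⟩ := exists_isFrame A hA
  obtain ⟨θ, hθ⟩ := hs.diffeo y A' hA'
  refine ⟨θ.toHomeomorph, fun j => ?_, fun K u hu => ?_⟩
  · have h1 := fderiv_ae_eq (f := Φ ∘ (extChartAt (𝓡 (m + 1)) x).symm)
      (F := fun s => Φs s ∘ (extChartAt (𝓡 (m + 1)) x).symm)
      (fun q => hs.represents _)
      (hasFDerivAt_comp_chart_symm hy (hΦ.mdifferentiableAt y)).differentiableAt
      (fun s => hasFDerivAt_comp_chart_symm hy (hs.mdifferentiableAt s y))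
      (A (EuclideanSpace.single j 1))
    filter_upwards [h1] with s h2
    rw [h2]
    have h3 := inner_riemGrad (g := g) (Φs s) y (A' (EuclideanSpace.single j 1))
    rw [← hθ s, hA', hA'e] at h3
    refine h3.symm.trans ?_
    simp [PiLp.inner_apply]
  · have h1 := hα A' θ.toEquiv hA' hθ
    have h2 : intL m (mulL m u ρ) = ∫ s, K (θ s) ∂(densityMeasure ρ) := by
      rw [integral_densityMeasure hρ]
      refine integral_congr_ae ?_
      filter_upwards [coeFn_mulL u ρ, hu] with s h3 h4
      rw [h3, h4]
      rfl
    have h3 : Continuous θ.toEquiv.symm := θ.symm.continuous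
    have h4 : Continuous θ := θ.continuous
    rw [h2, h1]
    refine (integral_map h3.aemeasurable (K.continuous.comp h4).aestronglyMeasurable).trans ?_
    refine integral_congr_ae (Eventually.of_forall fun s => ?_)
    exact congrArg K (θ.toEquiv.apply_symm_apply s)

/-- A special embedding is minimal with respect to a special metric. -/
theorem sum_localSecondForm_eq_zero_of_special {Φs : Sph m → M → ℝ} (hU : IsOpen U)
    (hΦ : IsSmoothIsometricImmersion g U G Φ) (hs : IsSpecialEmbedding g Φ Φs)
    (hG : IsSpecialMetric g U G Φ Φs)
    {Gt : Linf m → Ltwo m →L[ℝ] Ltwo m →L[ℝ] ℝ}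
    {p : Linf m → Eucl m} {D : Linf m → Ltwo m →L[ℝ] Eucl m} {x : M} {V : Linf m}
    (H : LocalModel G Gt (Φ ∘ (extChartAt (𝓡 (m + 1)) x).symm) p D (extChartAt (𝓡 (m + 1)) x x))
    (hV : IsNormal G Φ x V) {e : Module.Basis (Fin (m + 1)) ℝ (Eucl m)}
    (he : ∀ i j, inducedMetric Gt (Φ ∘ (extChartAt (𝓡 (m + 1)) x).symm)
      (extChartAt (𝓡 (m + 1)) x x) (e i) (e j) = if i = j then 1 else 0) :
    ∑ k, localSecondForm Gt (Φ ∘ (extChartAt (𝓡 (m + 1)) x).symm)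
      (extChartAt (𝓡 (m + 1)) x x) V (e k) (e k) = 0 := by
  obtain ⟨ρ, hρ, hρ0, hρs, hα⟩ := hG
  have hx := chart_symm_self Φ x
  have hUx : ∀ᶠ φ in 𝓝 ((Φ ∘ (extChartAt (𝓡 (m + 1)) x).symm) (extChartAt (𝓡 (m + 1)) x x)),
      φ ∈ U := by
    rw [hx]
    exact hU.mem_nhds (hΦ.mem x)
  have hnn : ∀ φ ∈ U, ∀ᵐ s ∂(sphereMeasure m), 0 ≤ ρ φ s := fun φ hφ => by
    obtain ⟨c, hc, h⟩ := hρ0 φ hφ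
    filter_upwards [h] with s hs using hc.le.trans hs
  refine H.sum_localSecondForm_eq_zero (n := ((m + 1 : ℕ) : ℝ)) (ρ := ρ) ?_ ?_ ?_ ?_ he ?_
  · exact (hρs.contDiffAt hUx).differentiableAt (by simp)
  · filter_upwards [hUx, H.metric_eq] with φ h1 h2 X Y
    rw [restrictForm_apply, h2, (hρ φ h1).2, integral_densityMeasure (hnn φ h1)]
    congr 1
    refine integral_congr_ae ?_
    filter_upwards [coeFn_mulL X Y, coeFn_mulL (mulL m X Y) (ρ φ)] with s h3 h4
    rw [h4, h3]
  · filter_upwards [hUx] with φ h1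
    have := (hρ φ h1).1
    have h2 := integral_densityMeasure (hnn φ h1) fun _ => 1
    simp only [integral_const, probReal_univ, one_smul, one_mul] at h2
    exact h2.symm
  · have hq : ∀ᶠ q in 𝓝 (extChartAt (𝓡 (m + 1)) x x), q ∈ (extChartAt (𝓡 (m + 1)) x).target :=
      extChartAt_target_mem_nhds x
    filter_upwards [hq, H.tendsto.eventually H.metric_eq] with q h1 h2 A hA
    obtain ⟨y, hy, rfl⟩ : ∃ y ∈ (extChartAt (𝓡 (m + 1)) x).source,
        extChartAt (𝓡 (m + 1)) x y = q :=
      ⟨_, (extChartAt (𝓡 (m + 1)) x).map_target h1, (extChartAt (𝓡 (m + 1)) x).right_inv h1⟩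
    have hfy : (Φ ∘ (extChartAt (𝓡 (m + 1)) x).symm) (extChartAt (𝓡 (m + 1)) x y) = Φ y :=
      congrArg Φ ((extChartAt (𝓡 (m + 1)) x).left_inv hy)
    rw [extChartAt_source] at hy
    rw [hfy] at h2 ⊢
    refine exists_homeomorph_of_special_embedding hΦ hs hy (hnn _ (hΦ.mem y)) (hα y) fun u v => ?_
    rw [← hΦ.isometric, ← hA, inducedMetric_apply, hfy, restrictForm_apply, h2,
      (hasFDerivAt_comp_chart_symm hy (hΦ.mdifferentiableAt y)).fderiv]
    rfl
  · intro v
    rw [hx]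
    exact hV.local hΦ H v

end Chart

/-- Near every point of the surface the problem is read in a chart, with an orthonormal basis. -/
theorem exists_localModel_basis {m : ℕ} {M : Type*} [TopologicalSpace M] [ChartedSpace (Eucl m) M]
    [IsManifold (𝓡 (m + 1)) ∞ M]
    {g : Bundle.ContMDiffRiemannianMetric (𝓡 (m + 1)) ∞ (Eucl m)
      (fun x : M => TangentSpace (𝓡 (m + 1)) x)}
    {U : Set (Linf m)} (hU : IsOpen U) {G : Linf m → LForm m} (hG : IsRiemannianMetric U G)
    {Φ : M → Linf m} (hΦ : IsSmoothIsometricImmersion g U G Φ)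
    {P : Linf m → M} (hP : IsProjection U G Φ P) (x : M) :
    ∃ (Gt : Linf m → Ltwo m →L[ℝ] Ltwo m →L[ℝ] ℝ) (p : Linf m → Eucl m)
      (D : Linf m → Ltwo m →L[ℝ] Eucl m) (e : Module.Basis (Fin (m + 1)) ℝ (Eucl m)),
      LocalModel G Gt (Φ ∘ (extChartAt (𝓡 (m + 1)) x).symm) p D (extChartAt (𝓡 (m + 1)) x x) ∧
      (∀ i j, inducedMetric Gt (Φ ∘ (extChartAt (𝓡 (m + 1)) x).symm)
        (extChartAt (𝓡 (m + 1)) x x) (e i) (e j) = if i = j then 1 else 0) ∧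
      ∃ J' : Linf m →L[ℝ] ℝ, HasFDerivAt (mapJacobian g G P) J' (Φ x) ∧
        ∀ V, IsNormal G Φ x V →
          J' V = ∑ k, localSecondForm Gt (Φ ∘ (extChartAt (𝓡 (m + 1)) x).symm)
            (extChartAt (𝓡 (m + 1)) x x) V (e k) (e k) := by
  obtain ⟨Gt, D, H, hJ⟩ := exists_localModel hU hG hΦ hP x
  obtain ⟨e, he⟩ := exists_orthonormal_basis H.inducedMetric_symm.self_of_nhds
    H.inducedMetric_pos.self_of_nhds
  obtain ⟨J', hJ', hJV⟩ := H.exists_hasFDerivAt_localJacobian he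
  rw [chart_symm_self] at hJ' hJV
  exact ⟨Gt, _, D, e, H, he, J', hJ'.congr_of_eventuallyEq hJ, fun V hV =>
    hJV V (hV.local hΦ H)⟩

end

theorem mainTheorem5 (m : ℕ) {M : Type*} [TopologicalSpace M] [ChartedSpace (Eucl m) M]
    [IsManifold (𝓡 (m + 1)) ∞ M]
    (g : Bundle.ContMDiffRiemannianMetric (𝓡 (m + 1)) ∞ (Eucl m)
      (fun x : M => TangentSpace (𝓡 (m + 1)) x))
    (U : Set (Linf m)) (hU : IsOpen U)
    (G : Linf m → LForm m) (hG : IsRiemannianMetric U G)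
    (Φ : M → Linf m) (hΦ : IsSmoothIsometricImmersion g U G Φ)
    (P : Linf m → M) (hP : IsProjection U G Φ P) :
    (∀ (x : M) (V : Linf m), IsNormal G Φ x V →
      ∃ H : ℝ, IsMeanCurvature U G Φ x V H ∧
        DifferentiableAt ℝ (mapJacobian g G P) (Φ x) ∧
        fderiv ℝ (mapJacobian g G P) (Φ x) V = H) ∧
    (∀ Φs : Sph m → M → ℝ, IsSpecialEmbedding g Φ Φs → IsSpecialMetric g U G Φ Φs →
      ∀ (x : M) (V : Linf m), IsNormal G Φ x V →
        DifferentiableAt ℝ (mapJacobian g G P) (Φ x) ∧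
        fderiv ℝ (mapJacobian g G P) (Φ x) V = 0) := by
  refine ⟨fun x V hV => ?_, fun Φs hs hGs x V hV => ?_⟩
  · obtain ⟨Gt, p, D, e, H, he, J', hJ', hJV⟩ := exists_localModel_basis hU hG hΦ hP x
    refine ⟨_, isMeanCurvature_sum hU hΦ H hV he, hJ'.differentiableAt, ?_⟩
    rw [hJ'.fderiv, hJV V hV]
  · obtain ⟨Gt, p, D, e, H, he, J', hJ', hJV⟩ := exists_localModel_basis hU hG hΦ hP x
    refine ⟨hJ'.differentiableAt, ?_⟩
    rw [hJ'.fderiv, hJV V hV,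
      sum_localSecondForm_eq_zero_of_special hU hΦ hs hGs H hV he]
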